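/- Let $F_\varepsilon$ be a family of area-preserving maps of the plane defined in a neighbourhood of the origin, depending on a real parameter $\varepsilon$ near $0$, which is analytic, or $C^\infty$, or formal (jointly in $(x,y,\varepsilon)$; a formal family is a pair of formal power series in $x,y,\varepsilon$). Area-preserving means that $\det\partial F_\varepsilon/\partial(x,y)$ is identically $1$ or identically $-1$; for an analytic or $C^\infty$ family, $|\det DF_\varepsilon|=1$. Assume that $F_0(0)=0$ and that $DF_0(0)$ has the double eigenvalue $-1$ and is not diagonalisable. Identify an analytic or $C^\infty$ family with its Taylor series in $(x,y,\varepsilon)$ at the origin. Then there exist real coefficients $u_{km}$ and a canonical formal change of variables $\phi_\varepsilon$ such that, as formal power series in $(x,y,\varepsilon)$, $$F_\varepsilon=\phi_\varepsilon^{-1}\circ\bigl(-\Phi^1_{h_\varepsilon}\bigr)\circ\phi_\varepsilon ,\qquad h_\varepsilon(x,y)=\frac{y^2}{2}+\sum_{\substack{k,m\ge0\\ k+2m\ge2}}u_{km}x^{2k}\varepsilon^m .$$ Here a canonical formal change of variables is a pair $\phi_\varepsilon(x,y)$ of real formal power series in $(x,y,\varepsilon)$ with $\phi_0(0)=0$ and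 Jacobian determinant with respect to $(x,y)$ equal to $1$ or to $-1$ (so it may reflect the orientation), and $\Phi^1_h=(\exp(L_h)x,\exp(L_h)y)$, where $L_hg=\frac{\partial g}{\partial x}\frac{\partial h}{\partial y}-\frac{\partial g}{\partial y}\frac{\partial h}{\partial x}$, is the formal time-one map of the Hamiltonian $h$. Moreover, all coefficients $u_{km}$ with $k\ge1$ and $k+2m\ge2$ are uniquely determined by the family $F_\varepsilon$: they are the same for every representation of this form, and no further non-degeneracy condition is needed. (The coefficients $u_{0m}$ of the terms depending on $\varepsilon$ only do not influence $\Phi^1_{h_\varepsilon}$ and are arbitrary.) -/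

import Mathlib

open MvPowerSeries
open scoped ContDiff

noncomputable section

namespace AreaPreservingNF

/-- Real formal power series in `x`, `y`, `ε`; the variables `0`, `1`, `2` are `x`, `y`, `ε`. -/
abbrev Series : Type := MvPowerSeries (Fin 3) ℝ

/-- A formal family of maps of the plane, `(x, y) ↦ (G 0, G 1)` with parameter `ε`. -/
abbrev FormalMap : Type := Fin 2 → Series

/-- The formal partial derivative with respect to `x`. -/
def dx (f : Series) : Series := MvPowerSeries.pderiv ℝ (0 : Fin 3) f

/-- The formal partial derivative with respect to `y`. -/
def dy (f : Series) : Series := MvPowerSeries.pderiv ℝ (1 : Fin 3) f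

/-- `G₀(0) = 0`, i.e. both components have zero constant term. Such families (which may move the
origin when `ε ≠ 0`) can be substituted into formal series. -/
def FixesOrigin (G : FormalMap) : Prop := ∀ i, constantCoeff (G i) = 0

/-- The Jacobian determinant with respect to `(x, y)`. -/
def jacobianDet (G : FormalMap) : Series := dx (G 0) * dy (G 1) - dy (G 0) * dx (G 1)

/-- Preservation of the area; the orientation may be preserved or reversed. -/
def IsAreaPreserving (G : FormalMap) : Prop := jacobianDet G = 1 ∨ jacobianDet G = -1

/-- The derivative `DG₀(0)` as an endomorphism of the plane. -/
def linearPart (G : FormalMap) : Module.End ℝ (Fin 2 → ℝ) :=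
  Matrix.toLin' !![constantCoeff (dx (G 0)), constantCoeff (dy (G 0));
                   constantCoeff (dx (G 1)), constantCoeff (dy (G 1))]

/-- The identity family `(x, y)`. -/
def idMap : FormalMap := ![X 0, X 1]

/-- The composition `G_ε ∘ H_ε` (meaningful when `H` fixes the origin at `ε = 0`):
`H 0`, `H 1` are substituted for `x`, `y`, and `ε` is left unchanged. -/
def comp (G H : FormalMap) : FormalMap :=
  fun i => MvPowerSeries.subst (![H 0, H 1, X 2] : Fin 3 → Series) (G i)

/-- `φ` is a canonical formal change of variables, possibly reflecting the orientation,
and `ψ` is its inverse. -/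
structure IsCanonicalChange (φ ψ : FormalMap) : Prop where
  fixes : FixesOrigin φ
  area : IsAreaPreserving φ
  fixes_inv : FixesOrigin ψ
  left_inv : comp ψ φ = idMap
  right_inv : comp φ ψ = idMap

/-- The Lie derivative `L_χ g = {g, χ} = ∂ₓg ∂ᵧχ - ∂ᵧg ∂ₓχ`. -/
def lieDeriv (χ g : Series) : Series := dx g * dy χ - dy g * dx χ

/-- The Lie series `exp(L_χ) g = ∑ₖ L_χᵏ g / k!`, summed coefficient by coefficient. Every
coefficient is a finite sum when `χ` contains only monomials `x^k y^l ε^m` with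
`2 k + 3 l + 6 m ≥ 6`, see `lieExp_finite`. -/
def lieExp (χ g : Series) : Series :=
  fun n => ∑ᶠ k : ℕ, coeff n ((lieDeriv χ)^[k] g) / (k.factorial : ℝ)

/-- The time-one map `Φ¹_χ = (exp(L_χ) x, exp(L_χ) y)` of the formal Hamiltonian `χ`. -/
def timeOne (χ : Series) : FormalMap := ![lieExp χ (X 0), lieExp χ (X 1)]

/-- The potential `∑_{k + 2 m ≥ 2} u k m x^(2 k) ε^m`. -/
def potential (u : ℕ → ℕ → ℝ) : Series :=
  fun n => if Even (n 0) ∧ n 1 = 0 ∧ 2 ≤ n 0 / 2 + 2 * n 2 then u (n 0 / 2) (n 2) else 0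

/-- The Hamiltonian `y² / 2 + ∑_{k + 2 m ≥ 2} u k m x^(2 k) ε^m`. -/
def normalHam (u : ℕ → ℕ → ℝ) : Series := C (1 / 2 : ℝ) * X 1 ^ 2 + potential u

/-- `T_ε = φ_ε⁻¹ ∘ (-Φ¹_{h_ε}) ∘ φ_ε` for a canonical formal change of variables `φ_ε`, where
`h_ε` is the Hamiltonian with coefficients `u`. -/
def HasNormalForm (T : FormalMap) (u : ℕ → ℕ → ℝ) : Prop :=
  ∃ φ ψ : FormalMap, IsCanonicalChange φ ψ ∧
    T = comp ψ (comp (-timeOne (normalHam u)) φ)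

/-- `A` has the double eigenvalue `μ` and is not diagonalisable. -/
def IsNondiagDouble (A : Module.End ℝ (Fin 2 → ℝ)) (μ : ℝ) : Prop :=
  A.charpoly = (Polynomial.X - Polynomial.C μ) ^ 2 ∧
    ¬ ∃ b : Module.Basis (Fin 2) ℝ (Fin 2 → ℝ), ∀ i, ∃ c : ℝ, A (b i) = c • b i

/-- The unit vectors in the directions `x`, `y`, `ε` of the space of all `(ε, (x, y))`. -/
def unitVec : Fin 3 → ℝ × (Fin 2 → ℝ) := ![(0, ![1, 0]), (0, ![0, 1]), (1, 0)]

/-- The partial derivative of a function of `(ε, (x, y))` with respect to the variable `j`. -/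
def partialDeriv (j : Fin 3) (f : ℝ × (Fin 2 → ℝ) → ℝ) : ℝ × (Fin 2 → ℝ) → ℝ :=
  fun q => fderiv ℝ f q (unitVec j)

/-- The Taylor series in `(x, y, ε)` at the origin of a family of maps `F_ε`: the coefficient of
`x^k y^l ε^m` in the component `i` is `∂ₓᵏ ∂ᵧˡ ∂_εᵐ F_i (0) / (k! l! m!)`. -/
def taylor (F : ℝ → (Fin 2 → ℝ) → (Fin 2 → ℝ)) : FormalMap :=
  fun i n =>
    ((partialDeriv 0)^[n 0] ((partialDeriv 1)^[n 1] ((partialDeriv 2)^[n 2]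
      (fun q => F q.1 q.2 i)))) (0, 0) / ((n 0).factorial * (n 1).factorial * (n 2).factorial : ℝ)

/-- The weight for which `x`, `y`, `ε` have the orders `2`, `3`, `6`. -/
def weight (n : Fin 3 →₀ ℕ) : ℕ := 2 * n 0 + 3 * n 1 + 6 * n 2

theorem coeff_lieDeriv_eq_zero {χ g : Series} {q : ℕ}
    (hχ : ∀ n, weight n < 6 → coeff n χ = 0) (hg : ∀ n, weight n < q → coeff n g = 0) :
    ∀ n, weight n < q + 1 → coeff n (lieDeriv χ g) = 0 := by
  intro n hn
  have key : ∀ i j : Fin 3, (i = 0 ∧ j = 1) ∨ (i = 1 ∧ j = 0) →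
      coeff n (MvPowerSeries.pderiv ℝ i g * MvPowerSeries.pderiv ℝ j χ) = 0 := by
    intro i j hij
    rw [coeff_mul]
    refine Finset.sum_eq_zero fun p hp => ?_
    have hp' : p.1 + p.2 = n := Finset.HasAntidiagonal.mem_antidiagonal.mp hp
    have hw : weight p.1 + weight p.2 = weight n := by
      rw [← hp']; simp only [weight, Finsupp.add_apply]; ring
    have hs : weight (p.1 + Finsupp.single i 1) + weight (p.2 + Finsupp.single j 1)
        = weight n + 5 := by
      rw [← hw]
      rcases hij with ⟨rfl, rfl⟩ | ⟨rfl, rfl⟩ <;> simp [weight] <;> ring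
    rw [coeff_pderiv, coeff_pderiv]
    by_cases h : weight (p.1 + Finsupp.single i 1) < q
    · rw [hg _ h]; ring
    · rw [hχ (p.2 + Finsupp.single j 1) (by omega)]; ring
  simp only [lieDeriv, dx, dy, map_sub]
  rw [key 0 1 (by simp), key 1 0 (by simp), sub_zero]

/-- The sums defining the coefficients of `exp(L_χ) g` are finite. -/
theorem lieExp_finite {χ : Series} (hχ : ∀ n, weight n < 6 → coeff n χ = 0) (g : Series)
    (n : Fin 3 →₀ ℕ) :
    (Function.support fun k : ℕ => coeff n ((lieDeriv χ)^[k] g) / (k.factorial : ℝ)).Finite := by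
  have h : ∀ k : ℕ, ∀ n, weight n < k → coeff n ((lieDeriv χ)^[k] g) = 0 := by
    intro k
    induction k with
    | zero => intro n hn; omega
    | succ k ih => rw [Function.iterate_succ_apply']; exact coeff_lieDeriv_eq_zero hχ ih
  refine (Set.finite_Iic (weight n)).subset fun k hk => ?_
  by_contra hlt
  exact hk (by simp [h k n (by simpa using hlt)])

theorem coeff_normalHam_eq_zero (u : ℕ → ℕ → ℝ) (n : Fin 3 →₀ ℕ) (hn : weight n < 6) :
    coeff n (normalHam u) = 0 := by
  unfold weight at hn
  rw [normalHam, map_add, coeff_C_mul, coeff_X_pow, if_neg, mul_zero, zero_add]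
  · refine if_neg fun h => ?_
    obtain ⟨⟨a, ha⟩, h1, h2⟩ := h
    omega
  · rintro rfl
    simp at hn

end AreaPreservingNF

end

/-
Give `x`, `y`, `ε` the weights `2`, `3`, `6`. The Poisson bracket lowers the weight by `5`, so a
Hamiltonian of weight at least `6` generates a formal flow, and `y² / 2`, of weight `6`, is the
leading part of `h_ε`. View formal maps as substitution automorphisms of the series ring. After a
linear change of variables the family is the reflection `(x, y) ↦ (-x, -y)` composed with an
automorphism `B` close to the identity, and it has to be shown that, writing `conj` for conjugation
by the reflection, `B ∘ conj A = A ∘ exp L_h` for some `A` close to the identity and exactly one `h`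
in normal form.

Existence is an elimination weight by weight. The part of the error that is odd under the reflection
is removed by a correction of `A`, since `A` and `conj A` feel it with opposite signs. In the even
part, the terms divisible by `y` are removed by solving the homological equation for the bracket
with `y² / 2`, and the terms in `x` and `ε` alone are absorbed into `h`.

For uniqueness, let `A = 1 + L_g + …` conjugate the normal forms of `h` and `k`. To leading order,
after symmetrization, `{g, y² / 2} = k - h`. The left side is divisible by `y` and the right side
depends on `x` and `ε` only, so both vanish, and the leading part of `g` is a function of `y²` and
`ε`. Replacing `y²` by `2h` makes it an integral of `h`, whose flow commutes with `exp L_h`;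
composing `A` with the inverse flow brings `A` closer to the identity.
-/

noncomputable section

namespace AreaPreservingNF

/-! ### Weighted power series and their operators -/

section WeightIdeal

variable {σ R : Type*} [CommRing R] {w : σ → ℕ} {f g : MvPowerSeries σ R} {p q : ℕ}

/-- The ideal of the power series all of whose monomials have weight at least `q`, the variable
`X i` having weight `w i`. -/
def weightIdeal (R : Type*) [CommRing R] (w : σ → ℕ) (q : ℕ) : Ideal (MvPowerSeries σ R) where
  carrier := {f | ∀ n, Finsupp.weight w n < q → coeff n f = 0}
  zero_mem' _ _ := map_zero _
  add_mem' hf hg n hn := by rw [map_add, hf n hn, hg n hn, add_zero]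
  smul_mem' g f hf n hn := by
    classical
    rw [smul_eq_mul, coeff_mul]
    refine Finset.sum_eq_zero fun a ha => ?_
    have hw := map_add (Finsupp.weight w) a.1 a.2
    rw [Finset.HasAntidiagonal.mem_antidiagonal.mp ha] at hw
    rw [hf _ (by omega), mul_zero]

theorem mem_weightIdeal :
    f ∈ weightIdeal R w q ↔ ∀ n, Finsupp.weight w n < q → coeff n f = 0 :=
  Iff.rfl

theorem weightIdeal_antitone : Antitone (weightIdeal R w) :=
  fun _ _ h _ hf n hn => hf n (hn.trans_le h)

@[simp] theorem weightIdeal_zero : weightIdeal R w 0 = ⊤ :=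
  top_unique fun _ _ _ hn => absurd hn (Nat.not_lt_zero _)

theorem mul_mem_weightIdeal (hf : f ∈ weightIdeal R w p) (hg : g ∈ weightIdeal R w q) :
    f * g ∈ weightIdeal R w (p + q) := by
  classical
  intro n hn
  rw [coeff_mul]
  refine Finset.sum_eq_zero fun a ha => ?_
  have hw := map_add (Finsupp.weight w) a.1 a.2
  rw [Finset.HasAntidiagonal.mem_antidiagonal.mp ha] at hw
  by_cases h : Finsupp.weight w a.1 < p
  · rw [hf _ h, zero_mul]
  · rw [hg _ (by omega), mul_zero]

theorem pow_mem_weightIdeal (hf : f ∈ weightIdeal R w p) (k : ℕ) :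
    f ^ k ∈ weightIdeal R w (k * p) := by
  induction k with
  | zero => simp
  | succ k ih => rw [pow_succ, add_one_mul]; exact mul_mem_weightIdeal ih hf

theorem pow_sub_pow_mem_weightIdeal (hf : f ∈ weightIdeal R w p) (hg : g ∈ weightIdeal R w p)
    (h : f - g ∈ weightIdeal R w (p + 1)) (k : ℕ) :
    f ^ k - g ^ k ∈ weightIdeal R w (k * p + 1) := by
  induction k with
  | zero => simp
  | succ k ih =>
    have hsplit : f ^ (k + 1) - g ^ (k + 1) = (f ^ k - g ^ k) * f + g ^ k * (f - g) := by ring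
    rw [hsplit, add_one_mul]
    exact add_mem (weightIdeal_antitone (by omega) (mul_mem_weightIdeal ih hf))
      (weightIdeal_antitone (by omega) (mul_mem_weightIdeal (pow_mem_weightIdeal hg k) h))

theorem eq_zero_of_forall_mem_weightIdeal (h : ∀ q, f ∈ weightIdeal R w q) : f = 0 := by
  ext n
  exact h _ n (Nat.lt_succ_self _)

theorem X_mem_weightIdeal (i : σ) : (X i : MvPowerSeries σ R) ∈ weightIdeal R w (w i) := by
  classical
  intro n hn
  rw [coeff_X, if_neg]
  rintro rfl
  simp [Finsupp.weight_single] at hn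

theorem mem_weightIdeal_one (hw : ∀ i, 0 < w i) :
    f ∈ weightIdeal R w 1 ↔ constantCoeff f = 0 := by
  refine ⟨fun h => h 0 (by simp), fun h n hn => ?_⟩
  have hn0 : n = 0 := by
    ext i
    have := Finsupp.le_weight w (hw i).ne' n
    simp only [Finsupp.coe_zero, Pi.zero_apply]
    omega
  rw [hn0, coeff_zero_eq_constantCoeff_apply, h]

-- The subtraction is truncated, which is harmless as `weightIdeal R w 0 = ⊤`.
theorem pderiv_mem_weightIdeal (hf : f ∈ weightIdeal R w q) (i : σ) :
    pderiv R i f ∈ weightIdeal R w (q - w i) := by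
  intro n hn
  rw [coeff_pderiv, hf, zero_mul]
  rw [map_add, Finsupp.weight_single, one_smul]
  omega

theorem coeff_eq_zero_of_pderiv_mem_weightIdeal [NoZeroDivisors R] [CharZero R] {i : σ}
    (hf : pderiv R i f ∈ weightIdeal R w q) {n : σ →₀ ℕ} (hi : n i ≠ 0)
    (hn : Finsupp.weight w n < q + w i) : coeff n f = 0 := by
  obtain ⟨m, rfl⟩ := exists_add_of_le (Finsupp.single_le_iff.mpr (Nat.one_le_iff_ne_zero.mpr hi))
  rw [map_add, Finsupp.weight_single, one_smul] at hn
  have h := hf m (by omega)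
  rw [coeff_pderiv, add_comm m] at h
  exact (mul_eq_zero.mp h).resolve_right (Nat.cast_add_one_ne_zero _)

theorem coeff_X_mul_eq_ite (i : σ) (f : MvPowerSeries σ R) (n : σ →₀ ℕ) :
    coeff n (X i * f) = if n i = 0 then 0 else coeff (n - Finsupp.single i 1) f := by
  classical
  simp only [X, coeff_monomial_mul, one_mul, Finsupp.single_le_iff, Nat.one_le_iff_ne_zero, ite_not]

-- Each monomial is divided by one of its variables, chosen arbitrarily.
theorem exists_eq_C_add_sum_X_mul [Fintype σ] (hf : f ∈ weightIdeal R w q) :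
    ∃ F : σ → MvPowerSeries σ R, f = C (constantCoeff f) + ∑ i, X i * F i ∧
      ∀ i, F i ∈ weightIdeal R w (q - w i) := by
  classical
  have hvar : ∀ n : σ →₀ ℕ, n ≠ 0 → ∃ j, n j ≠ 0 := fun n hn => Finsupp.ne_iff.mp hn
  choose v hv using hvar
  have hne : ∀ (n : σ →₀ ℕ) i, n + Finsupp.single i 1 ≠ 0 := fun n i => by simp
  let F : σ → MvPowerSeries σ R := fun i n =>
    if v _ (hne n i) = i then coeff (n + Finsupp.single i 1) f else 0
  have coeff_F : ∀ i n, coeff n (F i) =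
    if v _ (hne n i) = i then coeff (n + Finsupp.single i 1) f else 0 := fun _ _ => rfl
  refine ⟨F, ?_, fun i n hn => ?_⟩
  · ext n
    rcases eq_or_ne n 0 with rfl | hn
    · simp
    · have hterm : ∀ i, coeff n (X i * F i) = if v n hn = i then coeff n f else 0 := fun i => by
        rw [coeff_X_mul_eq_ite]
        rcases eq_or_ne (n i) 0 with hi | hi
        · rw [if_pos hi, if_neg]
          rintro rfl
          exact hv n hn hi
        · have h1 : n - Finsupp.single i 1 + Finsupp.single i 1 = n :=
            tsub_add_cancel_of_le (Finsupp.single_le_iff.mpr (Nat.one_le_iff_ne_zero.mpr hi))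
          simp only [if_neg hi, coeff_F, h1]
      rw [map_add, coeff_C, if_neg hn, zero_add, map_sum]
      simp [hterm]
  · rw [coeff_F]
    split_ifs
    · exact hf _ (by rw [map_add, Finsupp.weight_single, one_smul]; omega)
    · rfl

end WeightIdeal

section Raising

variable {σ R : Type*} [CommRing R] {w : σ → ℕ} {d e : ℕ}
  {S T : Module.End R (MvPowerSeries σ R)}

/-- The linear operators on power series that raise the weight by at least `d`. -/
def raising (R : Type*) [CommRing R] (w : σ → ℕ) (d : ℕ) :
    Submodule R (Module.End R (MvPowerSeries σ R)) where
  carrier := {T | ∀ q, ∀ f ∈ weightIdeal R w q, T f ∈ weightIdeal R w (q + d)}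
  zero_mem' _ _ _ := zero_mem _
  add_mem' hS hT q f hf := add_mem (hS q f hf) (hT q f hf)
  smul_mem' c _ hT q f hf := Submodule.smul_of_tower_mem _ c (hT q f hf)

theorem raising_antitone : Antitone (raising R w) :=
  fun _ _ h _ hT q f hf => weightIdeal_antitone (Nat.add_le_add_left h q) (hT q f hf)

theorem one_mem_raising_zero : 1 ∈ raising R w 0 := fun _ _ hf => hf

theorem mul_mem_raising (hS : S ∈ raising R w d) (hT : T ∈ raising R w e) :
    S * T ∈ raising R w (d + e) := fun q f hf => by
  rw [add_comm d, ← add_assoc]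
  exact hS _ _ (hT q f hf)

theorem pow_mem_raising (hT : T ∈ raising R w d) (k : ℕ) : T ^ k ∈ raising R w (k * d) := by
  induction k with
  | zero => simpa using one_mem_raising_zero
  | succ k ih => rw [pow_succ, add_one_mul]; exact mul_mem_raising ih hT

theorem mul_sub_mul_mem_raising {S' T' : Module.End R (MvPowerSeries σ R)}
    (hS : S - S' ∈ raising R w (d + 1)) (hS' : S' ∈ raising R w d)
    (hT : T ∈ raising R w e) (hTT' : T - T' ∈ raising R w (e + 1)) :
    S * T - S' * T' ∈ raising R w (d + e + 1) := by
  have hsplit : S * T - S' * T' = (S - S') * T + S' * (T - T') := by rw [sub_mul, mul_sub]; abel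
  rw [hsplit]
  exact add_mem (raising_antitone (by omega) (mul_mem_raising hS hT))
    (raising_antitone (by omega) (mul_mem_raising hS' hTT'))

theorem apply_mem_weightIdeal (hT : T ∈ raising R w d) (f : MvPowerSeries σ R) :
    T f ∈ weightIdeal R w d := by
  simpa using hT 0 f (by simp)

theorem eq_zero_of_forall_mem_raising (h : ∀ d, T ∈ raising R w d) : T = 0 :=
  LinearMap.ext fun f => eq_zero_of_forall_mem_weightIdeal fun d => apply_mem_weightIdeal (h d) f

theorem exists_sub_mem_raising {T : ℕ → Module.End R (MvPowerSeries σ R)}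
    (hT : ∀ k, T (k + 1) - T k ∈ raising R w (k + 1)) :
    ∃ S, ∀ k, S - T k ∈ raising R w (k + 1) := by
  have hmono : ∀ k j, T (k + j) - T k ∈ raising R w (k + 1) := fun k j => by
    induction j with
    | zero => simp
    | succ j ih =>
      rw [← sub_add_sub_cancel _ (T (k + j))]
      exact add_mem (raising_antitone (by omega) (hT (k + j))) ih
  let S : Module.End R (MvPowerSeries σ R) :=
    { toFun := fun f n => coeff n (T (Finsupp.weight w n) f)
      map_add' := fun f g => by ext n; simp only [coeff_apply, map_add]; rfl
      map_smul' := fun c f => by ext n; simp only [coeff_apply, map_smul]; rfl }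
  refine ⟨S, fun k q f hf n hn => ?_⟩
  have hS : coeff n (S f) = coeff n (T (Finsupp.weight w n) f) := rfl
  rw [LinearMap.sub_apply, map_sub, hS, ← map_sub, ← LinearMap.sub_apply]
  rcases le_total k (Finsupp.weight w n) with h | h
  · have := hmono k (Finsupp.weight w n - k) q f hf n hn
    rwa [Nat.add_sub_cancel' h] at this
  · have := apply_mem_weightIdeal (hmono (Finsupp.weight w n) (k - Finsupp.weight w n)) f n
      (Nat.lt_succ_self _)
    rw [Nat.add_sub_cancel' h] at this
    rw [← neg_sub, LinearMap.neg_apply, map_neg, this, neg_zero]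

-- The inverse is the Neumann series `∑ (1 - T) ^ k`.
theorem isUnit_of_sub_one_mem_raising (hT : T - 1 ∈ raising R w 1) : IsUnit T := by
  obtain ⟨U, rfl⟩ : ∃ U, T = 1 - U := ⟨1 - T, by abel⟩
  have hU : U ∈ raising R w 1 := by simpa using neg_mem hT
  have hpow : ∀ k, U ^ (k + 1) ∈ raising R w (k + 1) := fun k => by
    simpa using pow_mem_raising hU (k + 1)
  obtain ⟨S, hS⟩ := exists_sub_mem_raising
    (T := fun k => ∑ i ∈ Finset.range (k + 1), U ^ i) (w := w) fun k => by
      rw [Finset.sum_range_succ, add_sub_cancel_left]; exact hpow k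
  have hT0 : 1 - U ∈ raising R w 0 :=
    sub_mem one_mem_raising_zero (raising_antitone zero_le_one hU)
  have heq : ∀ V, (∀ k, V - 1 ∈ raising R w (k + 1)) → V = 1 := fun V hV =>
    sub_eq_zero.mp (eq_zero_of_forall_mem_raising (w := w) fun k =>
      raising_antitone k.le_succ (hV k))
  refine ⟨⟨1 - U, S, heq _ fun k => ?_, heq _ fun k => ?_⟩, rfl⟩
  · have h := mul_mem_raising hT0 (hS k)
    rw [mul_sub, mul_neg_geom_sum] at h
    rw [zero_add] at h
    convert sub_mem h (hpow k) using 1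
    abel
  · have h := mul_mem_raising (hS k) hT0
    rw [sub_mul, geom_sum_mul_neg] at h
    convert sub_mem h (hpow k) using 1
    abel

theorem mem_raising_of_X [Finite σ] (hw : ∀ i, 0 < w i) {a : σ → MvPowerSeries σ R}
    (ha : ∀ i, a i ∈ weightIdeal R w (w i)) (hC : ∀ c, T (C c) ∈ weightIdeal R w d)
    (hX : ∀ i q, ∀ f ∈ weightIdeal R w q,
      T (X i * f) - a i * T f ∈ weightIdeal R w (q + w i + d)) :
    T ∈ raising R w d := by
  cases nonempty_fintype σ
  have key : ∀ N q, ∀ f ∈ weightIdeal R w q, T f ∈ weightIdeal R w (min (q + d) N) := by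
    intro N
    induction N with
    | zero => simp
    | succ N ih =>
      intro q f hf
      have hconst : T (C (constantCoeff f)) ∈ weightIdeal R w (q + d) := by
        rcases q.eq_zero_or_pos with rfl | hq
        · simpa using hC _
        · rw [(mem_weightIdeal_one hw).mp (weightIdeal_antitone hq hf), map_zero, map_zero]
          exact zero_mem _
      obtain ⟨F, hF, hFq⟩ := exists_eq_C_add_sum_X_mul hf
      rw [hF, map_add, map_sum]
      refine add_mem (weightIdeal_antitone (min_le_left _ _) hconst) (sum_mem fun i _ => ?_)
      have hi := hw i
      rw [← sub_add_cancel (T (X i * F i)) (a i * T (F i))]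
      exact add_mem (weightIdeal_antitone (by omega) (hX i _ _ (hFq i)))
        (weightIdeal_antitone (by omega) (mul_mem_weightIdeal (ha i) (ih _ _ (hFq i))))
  intro q f hf
  simpa using key (q + d) q f hf

end Raising

section AlgHom

variable {σ R : Type*} [CommRing R] {w : σ → ℕ} {d : ℕ}
  {A B : MvPowerSeries σ R →ₐ[R] MvPowerSeries σ R}

theorem algHom_C (A : MvPowerSeries σ R →ₐ[R] MvPowerSeries σ R) (c : R) : A (C c) = C c :=
  A.commutes c

theorem algHom_mem_raising_zero [Finite σ] (hw : ∀ i, 0 < w i)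
    (hA : ∀ i, A (X i) ∈ weightIdeal R w (w i)) :
    A.toLinearMap ∈ raising R w 0 :=
  mem_raising_of_X hw hA (by simp) fun i q f _ => by simp

theorem algHom_sub_mem_raising [Finite σ] (hw : ∀ i, 0 < w i)
    (hA : A.toLinearMap ∈ raising R w 0) (hB : ∀ i, B (X i) ∈ weightIdeal R w (w i))
    (h : ∀ i, A (X i) - B (X i) ∈ weightIdeal R w (w i + d)) :
    A.toLinearMap - B.toLinearMap ∈ raising R w d := by
  refine mem_raising_of_X hw hB (by simp [algHom_C]) fun i q f hf => ?_
  have : (A.toLinearMap - B.toLinearMap) (X i * f) - B (X i) * (A.toLinearMap - B.toLinearMap) f =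
      A f * (A (X i) - B (X i)) := by
    simp only [LinearMap.sub_apply, AlgHom.toLinearMap_apply, map_mul]; ring
  rw [this]
  exact weightIdeal_antitone (by omega) (mul_mem_weightIdeal (hA q f hf) (h i))

-- Giving all variables weight one, such an operator raises the weight by any amount.
theorem eq_zero_of_apply_X_mul [Finite σ] {K : Module.End R (MvPowerSeries σ R)}
    {a : σ → MvPowerSeries σ R} (ha : ∀ i, constantCoeff (a i) = 0)
    (hC : ∀ c, K (C c) = 0)
    (hX : ∀ i f, K (X i * f) = a i * K f) : K = 0 :=
  have hw : ∀ i : σ, 0 < (1 : σ → ℕ) i := fun _ => one_pos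
  eq_zero_of_forall_mem_raising (w := 1) fun d =>
    mem_raising_of_X hw (fun i => (mem_weightIdeal_one hw).mpr (ha i)) (by simp [hC])
      (by simp [hX])

theorem algHom_ext [Finite σ] (hA : ∀ i, constantCoeff (A (X i)) = 0)
    (h : ∀ i, A (X i) = B (X i)) : A = B := by
  have : A.toLinearMap - B.toLinearMap = 0 :=
    eq_zero_of_apply_X_mul hA (by simp [algHom_C]) fun i f => by simp [h, mul_sub]
  exact AlgHom.toLinearMap_injective (sub_eq_zero.mp this)

theorem constantCoeff_algHom [Finite σ] (hA : ∀ i, constantCoeff (A (X i)) = 0)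
    (f : MvPowerSeries σ R) : constantCoeff (A f) = constantCoeff f := by
  cases nonempty_fintype σ
  obtain ⟨F, hF, -⟩ := exists_eq_C_add_sum_X_mul (w := 0) (q := 0) (f := f) (by simp)
  rw [hF]
  simp [algHom_C, hA]

theorem derivation_algHom_apply [Fintype σ] (hA : ∀ i, constantCoeff (A (X i)) = 0)
    (D : Derivation R (MvPowerSeries σ R) (MvPowerSeries σ R)) (f : MvPowerSeries σ R) :
    D (A f) = ∑ i, A (pderiv R i f) * D (A (X i)) := by
  classical
  let K : Module.End R (MvPowerSeries σ R) := D.toLinearMap ∘ₗ A.toLinearMap -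
    ∑ i, LinearMap.mulRight R (D (A (X i))) ∘ₗ A.toLinearMap ∘ₗ (pderiv R i).toLinearMap
  have hK : ∀ f, K f = D (A f) - ∑ i, A (pderiv R i f) * D (A (X i)) := fun f => by simp [K]
  have hK0 : K = 0 := by
    refine eq_zero_of_apply_X_mul hA (fun c => ?_) fun i f => ?_
    · have : D (C c) = 0 := D.map_algebraMap c
      simp [hK, algHom_C, this]
    · have hpderiv : ∀ j, pderiv R j (X i * f) =
          (if j = i then f else 0) + X i * pderiv R j f := fun j => by
        rcases eq_or_ne j i with rfl | h
        · simp [add_comm]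
        · simp [pderiv_X_of_ne h.symm, h]
      simp only [hK, hpderiv, map_mul, map_add, add_mul, Derivation.leibniz, smul_eq_mul,
        Finset.sum_add_distrib, apply_ite A, map_zero, ite_mul, zero_mul, Finset.sum_ite_eq',
        Finset.mem_univ, if_true, mul_assoc, mul_sub, Finset.mul_sum]
      ring
  exact sub_eq_zero.mp ((hK f).symm.trans (by rw [hK0, LinearMap.zero_apply]))

theorem exists_algHom_sub_mem_raising
    {T : ℕ → MvPowerSeries σ R →ₐ[R] MvPowerSeries σ R}
    (hT : ∀ k, (T (k + 1)).toLinearMap - (T k).toLinearMap ∈ raising R w (k + 1)) :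
    ∃ L : MvPowerSeries σ R →ₐ[R] MvPowerSeries σ R,
      ∀ k, L.toLinearMap - (T k).toLinearMap ∈ raising R w (k + 1) := by
  obtain ⟨S, hS⟩ := exists_sub_mem_raising (T := fun k => (T k).toLinearMap) hT
  have hST : ∀ k f, S f - T k f ∈ weightIdeal R w k := fun k f =>
    weightIdeal_antitone k.le_succ (apply_mem_weightIdeal (hS k) f)
  have hone : S 1 = 1 := sub_eq_zero.mp <| eq_zero_of_forall_mem_weightIdeal fun k => by
    simpa using hST k 1
  have hmul : ∀ f g, S (f * g) = S f * S g := fun f g =>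
    sub_eq_zero.mp <| eq_zero_of_forall_mem_weightIdeal fun k => by
      have hsplit : S (f * g) - S f * S g = (S (f * g) - T k (f * g))
          - (S g * (S f - T k f) + T k f * (S g - T k g)) := by rw [map_mul (T k)]; ring
      rw [hsplit]
      exact sub_mem (hST k _)
        (add_mem (Ideal.mul_mem_left _ _ (hST k f)) (Ideal.mul_mem_left _ _ (hST k g)))
  exact ⟨AlgHom.ofLinearMap S hone hmul, hS⟩

end AlgHom

theorem pderiv_comm {σ R : Type*} [CommSemiring R] (i j : σ) (f : MvPowerSeries σ R) :
    pderiv R i (pderiv R j f) = pderiv R j (pderiv R i f) := by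
  ext n
  rcases eq_or_ne i j with rfl | h
  · rfl
  · simp [coeff_pderiv, add_right_comm, Finsupp.single_eq_of_ne h, Finsupp.single_eq_of_ne h.symm,
      mul_right_comm]

section Primitive

variable {σ K : Type*} [Field K] {w : σ → ℕ} {q : ℕ} {f : MvPowerSeries σ K}

/-- The formal primitive `∫ f dXᵢ` without terms free of `X i`; for those terms the definition
relies on `c / 0 = 0`. -/
def primitive (i : σ) (f : MvPowerSeries σ K) : MvPowerSeries σ K :=
  fun n => coeff (n - Finsupp.single i 1) f / n i

theorem coeff_primitive (i : σ) (f : MvPowerSeries σ K) (n : σ →₀ ℕ) :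
    coeff n (primitive i f) = coeff (n - Finsupp.single i 1) f / n i :=
  rfl

@[simp] theorem primitive_zero (i : σ) : primitive i (0 : MvPowerSeries σ K) = 0 := by
  ext n
  simp [coeff_primitive]

@[simp] theorem pderiv_primitive [CharZero K] (i : σ) (f : MvPowerSeries σ K) :
    pderiv K i (primitive i f) = f := by
  ext n
  have : (n i : K) + 1 ≠ 0 := by exact_mod_cast (n i).succ_ne_zero
  simp [coeff_pderiv, coeff_primitive, this]

theorem pderiv_primitive_of_ne {i j : σ} (h : i ≠ j) (f : MvPowerSeries σ K) :
    pderiv K j (primitive i f) = primitive i (pderiv K j f) := by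
  ext n
  have hij : n + Finsupp.single j 1 - Finsupp.single i 1 =
      n - Finsupp.single i 1 + Finsupp.single j 1 ∨ (n i : K) = 0 := by
    rcases Nat.eq_zero_or_pos (n i) with h0 | h0
    · exact Or.inr (by rw [h0, Nat.cast_zero])
    · exact Or.inl (tsub_add_eq_add_tsub (Finsupp.single_le_iff.mpr h0)).symm
  rcases hij with hij | hij
  · simp [coeff_pderiv, coeff_primitive, hij, h.symm, h, div_mul_eq_mul_div]
  · simp [coeff_pderiv, coeff_primitive, hij, h]

theorem primitive_mem_weightIdeal (hf : f ∈ weightIdeal K w q) (i : σ) :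
    primitive i f ∈ weightIdeal K w (q + w i) := by
  intro n hn
  rcases Nat.eq_zero_or_pos (n i) with h0 | h0
  · simp [coeff_primitive, h0]
  · have hle : Finsupp.single i 1 ≤ n := Finsupp.single_le_iff.mpr h0
    have hw := congrArg (Finsupp.weight w) (tsub_add_cancel_of_le hle)
    rw [map_add, Finsupp.weight_single, one_smul] at hw
    rw [coeff_primitive, hf _ (by omega), zero_div]

end Primitive

/-- The weights `2`, `3`, `6` of the variables `x`, `y`, `ε`; for these `y² / 2 + a x⁴ + …` has
weight at least `6`, and the Poisson bracket lowers the weight by `5`. -/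
def varWeight : Fin 3 → ℕ := ![2, 3, 6]

/-- The filtration of `Series` by the weight, with `x`, `y`, `ε` of weight `2`, `3`, `6`. -/
local notation "𝓕" => weightIdeal ℝ varWeight

/-- The filtration of the operators on `Series` by the amount they raise the weight. -/
local notation "𝓡" => raising ℝ varWeight

theorem weight_varWeight (n : Fin 3 →₀ ℕ) : Finsupp.weight varWeight n = weight n := by
  rw [Finsupp.weight_apply, Finsupp.sum_fintype _ _ (by simp), Fin.sum_univ_three]
  simp only [varWeight, weight, smul_eq_mul, Matrix.cons_val]
  ring

theorem weight_add (m n : Fin 3 →₀ ℕ) : weight (m + n) = weight m + weight n := by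
  simp only [← weight_varWeight, map_add]

@[simp] theorem weight_single (i : Fin 3) (k : ℕ) :
    weight (Finsupp.single i k) = k * varWeight i := by
  rw [← weight_varWeight, Finsupp.weight_single, smul_eq_mul]

theorem varWeight_pos (i : Fin 3) : 0 < varWeight i := by
  fin_cases i <;> simp [varWeight]

theorem mem_fil {f : Series} {q : ℕ} : f ∈ 𝓕 q ↔ ∀ n, weight n < q → coeff n f = 0 := by
  simp only [mem_weightIdeal, weight_varWeight]

theorem mem_fil_one {f : Series} : f ∈ 𝓕 1 ↔ constantCoeff f = 0 :=
  mem_weightIdeal_one varWeight_pos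

theorem fil_mono {f : Series} {p q : ℕ} (hf : f ∈ 𝓕 p) (h : q ≤ p) : f ∈ 𝓕 q :=
  weightIdeal_antitone h hf

theorem raising_mono {T : Module.End ℝ Series} {d e : ℕ} (hT : T ∈ 𝓡 d) (h : e ≤ d) : T ∈ 𝓡 e :=
  raising_antitone h hT

theorem eq_of_forall_sub_mem_fil {f g : Series} (h : ∀ N, f - g ∈ 𝓕 N) : f = g :=
  sub_eq_zero.mp (eq_zero_of_forall_mem_weightIdeal h)

theorem eq_of_forall_sub_mem_raising {S T : Module.End ℝ Series} (h : ∀ N, S - T ∈ 𝓡 N) : S = T :=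
  sub_eq_zero.mp (eq_zero_of_forall_mem_raising h)

theorem dx_mul (f g : Series) : dx (f * g) = dx f * g + f * dx g := by
  simp only [dx, Derivation.leibniz, smul_eq_mul]; ring

theorem dy_mul (f g : Series) : dy (f * g) = dy f * g + f * dy g := by
  simp only [dy, Derivation.leibniz, smul_eq_mul]; ring

@[simp] theorem dx_add (f g : Series) : dx (f + g) = dx f + dx g := map_add _ _ _
@[simp] theorem dy_add (f g : Series) : dy (f + g) = dy f + dy g := map_add _ _ _
@[simp] theorem dx_sub (f g : Series) : dx (f - g) = dx f - dx g := map_sub _ _ _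
@[simp] theorem dy_sub (f g : Series) : dy (f - g) = dy f - dy g := map_sub _ _ _
@[simp] theorem dx_neg (f : Series) : dx (-f) = -dx f := map_neg _ _
@[simp] theorem dy_neg (f : Series) : dy (-f) = -dy f := map_neg _ _
@[simp] theorem dx_smul (c : ℝ) (f : Series) : dx (c • f) = c • dx f := Derivation.map_smul _ _ _
@[simp] theorem dy_smul (c : ℝ) (f : Series) : dy (c • f) = c • dy f := Derivation.map_smul _ _ _
@[simp] theorem dx_C (c : ℝ) : dx (C c) = 0 := pderiv_C
@[simp] theorem dy_C (c : ℝ) : dy (C c) = 0 := pderiv_C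
@[simp] theorem dx_X_zero : dx (X 0) = 1 := pderiv_X_self
@[simp] theorem dx_X_one : dx (X 1) = 0 := pderiv_X_of_ne (by decide)
@[simp] theorem dx_X_two : dx (X 2) = 0 := pderiv_X_of_ne (by decide)
@[simp] theorem dy_X_zero : dy (X 0) = 0 := pderiv_X_of_ne (by decide)
@[simp] theorem dy_X_one : dy (X 1) = 1 := pderiv_X_self
@[simp] theorem dy_X_two : dy (X 2) = 0 := pderiv_X_of_ne (by decide)

theorem coeff_dx (f : Series) (n : Fin 3 →₀ ℕ) :
    coeff n (dx f) = coeff (n + Finsupp.single 0 1) f * (n 0 + 1) := coeff_pderiv f n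

theorem coeff_dy (f : Series) (n : Fin 3 →₀ ℕ) :
    coeff n (dy f) = coeff (n + Finsupp.single 1 1) f * (n 1 + 1) := coeff_pderiv f n

theorem dx_dy (f : Series) : dx (dy f) = dy (dx f) := pderiv_comm 0 1 f

theorem dx_mem_fil {f : Series} {q : ℕ} (hf : f ∈ 𝓕 q) : dx f ∈ 𝓕 (q - 2) :=
  pderiv_mem_weightIdeal hf 0

theorem dy_mem_fil {f : Series} {q : ℕ} (hf : f ∈ 𝓕 q) : dy f ∈ 𝓕 (q - 3) :=
  pderiv_mem_weightIdeal hf 1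

/-! ### Poisson brackets and Lie series -/

section PoissonBracket

variable {A : Series →ₐ[ℝ] Series} {χ f g : Series} {p q r d : ℕ}

/-- The Poisson bracket as a bilinear map, with `lieOp χ = L_χ`. -/
def lieOp : Series →ₗ[ℝ] Module.End ℝ Series :=
  LinearMap.mk₂ ℝ lieDeriv
    (fun χ η f => by simp only [lieDeriv, dx_add, dy_add]; ring)
    (fun c χ f => by simp only [lieDeriv, dx_smul, dy_smul, mul_smul_comm, smul_sub])
    (fun χ f g => by simp only [lieDeriv, dx_add, dy_add]; ring)
    (fun c χ f => by simp only [lieDeriv, dx_smul, dy_smul, smul_mul_assoc, smul_sub])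

@[simp] theorem lieOp_apply (χ f : Series) : lieOp χ f = lieDeriv χ f := rfl

theorem lieDeriv_mul (χ f g : Series) :
    lieDeriv χ (f * g) = lieDeriv χ f * g + f * lieDeriv χ g := by
  simp only [lieDeriv, dx_mul, dy_mul]; ring

theorem lieDeriv_lieDeriv (χ f g : Series) :
    lieDeriv χ (lieDeriv f g) = lieDeriv (lieDeriv χ f) g + lieDeriv f (lieDeriv χ g) := by
  simp only [lieDeriv, dx_mul, dy_mul, dx_sub, dy_sub, dx_dy]; ring

@[simp] theorem lieDeriv_self (f : Series) : lieDeriv f f = 0 := by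
  simp only [lieDeriv]; ring

@[simp] theorem lieDeriv_C (χ : Series) (c : ℝ) : lieDeriv χ (C c) = 0 := by simp [lieDeriv]
@[simp] theorem lieDeriv_X_zero (χ : Series) : lieDeriv χ (X 0) = dy χ := by simp [lieDeriv]
@[simp] theorem lieDeriv_X_one (χ : Series) : lieDeriv χ (X 1) = -dx χ := by simp [lieDeriv]
@[simp] theorem lieDeriv_X_two (χ : Series) : lieDeriv χ (X 2) = 0 := by simp [lieDeriv]

theorem lieOp_commutator (f g : Series) :
    lieOp f * lieOp g - lieOp g * lieOp f = lieOp (lieDeriv f g) := by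
  ext1 h
  simp only [LinearMap.sub_apply, Module.End.mul_apply, lieOp_apply]
  rw [lieDeriv_lieDeriv]; ring

theorem lieDeriv_mem_fil (hf : f ∈ 𝓕 p) (hg : g ∈ 𝓕 q) (hr : r + 5 ≤ p + q) :
    lieDeriv f g ∈ 𝓕 r :=
  sub_mem (fil_mono (mul_mem_weightIdeal (dx_mem_fil hg) (dy_mem_fil hf)) (by omega))
    (fil_mono (mul_mem_weightIdeal (dy_mem_fil hg) (dx_mem_fil hf)) (by omega))

theorem lieOp_mem_raising (hχ : χ ∈ 𝓕 (d + 5)) : lieOp χ ∈ 𝓡 d :=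
  fun _ _ hg => lieDeriv_mem_fil hχ hg (by omega)

theorem dx_algHom (hA : ∀ i, constantCoeff (A (X i)) = 0) (hε : A (X 2) = X 2) (f : Series) :
    dx (A f) = A (dx f) * dx (A (X 0)) + A (dy f) * dx (A (X 1)) := by
  have h := derivation_algHom_apply hA (pderiv ℝ 0) f
  rwa [Fin.sum_univ_three, hε, pderiv_X_of_ne (by decide), mul_zero, add_zero] at h

theorem dy_algHom (hA : ∀ i, constantCoeff (A (X i)) = 0) (hε : A (X 2) = X 2) (f : Series) :
    dy (A f) = A (dx f) * dy (A (X 0)) + A (dy f) * dy (A (X 1)) := by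
  have h := derivation_algHom_apply hA (pderiv ℝ 1) f
  rwa [Fin.sum_univ_three, hε, pderiv_X_of_ne (by decide), mul_zero, add_zero] at h

theorem lieDeriv_algHom (hA : ∀ i, constantCoeff (A (X i)) = 0) (hε : A (X 2) = X 2)
    (f g : Series) :
    lieDeriv (A f) (A g) = A (lieDeriv f g) * lieDeriv (A (X 1)) (A (X 0)) := by
  simp only [lieDeriv, dx_algHom hA hε f, dy_algHom hA hε f, dx_algHom hA hε g,
    dy_algHom hA hε g, map_sub, map_mul]
  ring

end PoissonBracket

section LieSeries

open Finset.HasAntidiagonal (antidiagonal mem_antidiagonal)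

variable {χ η f g : Series} {d q : ℕ}

/-- The partial sums of the Lie series `exp(L_χ)`. -/
def lieSum (χ : Series) (N : ℕ) : Module.End ℝ Series :=
  ∑ k ∈ Finset.range N, (k.factorial : ℝ)⁻¹ • lieOp χ ^ k

theorem iterate_lieDeriv (χ g : Series) (k : ℕ) : (lieDeriv χ)^[k] g = (lieOp χ ^ k) g := by
  rw [Module.End.pow_apply]; rfl

theorem lieOp_pow_mem_raising (hχ : χ ∈ 𝓕 (d + 5)) (k : ℕ) : lieOp χ ^ k ∈ 𝓡 (k * d) :=
  pow_mem_raising (lieOp_mem_raising hχ) k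

theorem lieExp_sub_lieSum_mem_fil (hχ : χ ∈ 𝓕 6) (hg : g ∈ 𝓕 q) (N : ℕ) :
    lieExp χ g - lieSum χ N g ∈ 𝓕 (q + N) := by
  rw [mem_fil]
  intro n hn
  have hvanish : ∀ k, N ≤ k → coeff n ((lieOp χ ^ k) g) = 0 := fun k hk =>
    mem_fil.mp (lieOp_pow_mem_raising (d := 1) hχ k q g hg) n (by omega)
  have hsum : coeff n (lieExp χ g) =
      ∑ᶠ k : ℕ, coeff n ((lieDeriv χ)^[k] g) / (k.factorial : ℝ) := rfl
  rw [map_sub, sub_eq_zero, lieSum, LinearMap.sum_apply, map_sum, hsum,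
    finsum_eq_sum_of_support_subset (s := Finset.range N)]
  · refine Finset.sum_congr rfl fun k _ => ?_
    rw [iterate_lieDeriv, LinearMap.smul_apply, map_smul, smul_eq_mul, div_eq_inv_mul]
  · refine fun k hk => ?_
    by_contra h
    simp only [Finset.coe_range, Set.mem_Iio, not_lt] at h
    exact hk (by simp only [iterate_lieDeriv, hvanish k h, zero_div])

theorem lieExp_eq_of_lieDeriv_eq_zero (hχ : χ ∈ 𝓕 6) (h : lieDeriv χ g = 0) :
    lieExp χ g = g := by
  refine eq_of_forall_sub_mem_fil fun N => ?_
  have hsum : lieSum χ (N + 1) g = g := by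
    rw [lieSum, Finset.sum_range_succ', LinearMap.add_apply, LinearMap.sum_apply,
      Finset.sum_eq_zero fun k _ => by
        rw [pow_succ, LinearMap.smul_apply, Module.End.mul_apply, lieOp_apply, h, map_zero,
          smul_zero]]
    simp
  have := lieExp_sub_lieSum_mem_fil (q := 0) (g := g) hχ (by simp) (N + 1)
  rw [hsum] at this
  exact fil_mono this (by omega)

theorem lieExp_add (hχ : χ ∈ 𝓕 6) (f g : Series) :
    lieExp χ (f + g) = lieExp χ f + lieExp χ g := by
  refine eq_of_forall_sub_mem_fil fun N => ?_
  have h : ∀ f, lieExp χ f - lieSum χ N f ∈ 𝓕 N := fun f => by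
    simpa using lieExp_sub_lieSum_mem_fil (q := 0) (g := f) hχ (by simp) N
  have hsub := sub_mem (sub_mem (h (f + g)) (h f)) (h g)
  rw [map_add] at hsub
  convert hsub using 1
  ring

theorem sum_product_range_eq_sum_antidiagonal_add {M : Type*} [AddCommMonoid M] (N : ℕ)
    (a : ℕ → ℕ → M) :
    ∑ i ∈ Finset.range N, ∑ j ∈ Finset.range N, a i j =
      ∑ k ∈ Finset.range N, ∑ p ∈ antidiagonal k, a p.1 p.2 +
      ∑ p ∈ (Finset.range N ×ˢ Finset.range N) with ¬ (p.1 + p.2 < N), a p.1 p.2 := by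
  classical
  rw [← Finset.sum_product' (f := a),
    ← Finset.sum_filter_add_sum_filter_not _ (fun p => p.1 + p.2 < N)]
  congr 1
  rw [← Finset.sum_fiberwise_of_maps_to (t := Finset.range N) (g := fun p : ℕ × ℕ => p.1 + p.2)]
  · refine Finset.sum_congr rfl fun k hk => Finset.sum_congr ?_ fun _ _ => rfl
    ext p
    simp only [Finset.mem_filter, Finset.mem_product, Finset.mem_range,
      mem_antidiagonal] at hk ⊢
    omega
  · intro p hp
    simp only [Finset.mem_filter, Finset.mem_range] at hp ⊢
    exact hp.2

theorem pow_bilinear_eq_sum_antidiagonal {K E : Type*} [Field K] [CharZero K] [AddCommGroup E]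
    [Module K E] {β : E →ₗ[K] E →ₗ[K] E} {L : Module.End K E}
    (hL : ∀ f g, L (β f g) = β (L f) g + β f (L g)) (k : ℕ) (f g : E) :
    (k.factorial : K)⁻¹ • (L ^ k) (β f g) = ∑ p ∈ antidiagonal k,
      β ((p.1.factorial : K)⁻¹ • (L ^ p.1) f) ((p.2.factorial : K)⁻¹ • (L ^ p.2) g) := by
  set a : ℕ → E → E := fun k f => (k.factorial : K)⁻¹ • (L ^ k) f with ha_def
  change a k (β f g) = ∑ p ∈ antidiagonal k, β (a p.1 f) (a p.2 g)
  have hsucc : ∀ k f, L (a k f) = (k + 1 : K) • a (k + 1) f := fun k f => by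
    have : (k : K) + 1 ≠ 0 := Nat.cast_add_one_ne_zero k
    simp only [ha_def, map_smul, pow_succ', Module.End.mul_apply, smul_smul]
    rw [Nat.factorial_succ, Nat.cast_mul, mul_inv, Nat.cast_succ, mul_inv_cancel_left₀ this]
  induction k with
  | zero => simp [ha_def]
  | succ k ih =>
    refine smul_right_injective E (Nat.cast_add_one_ne_zero (R := K) k) ?_
    have hleft : ∑ p ∈ antidiagonal (k + 1), (p.1 : K) • β (a p.1 f) (a p.2 g) =
        ∑ p ∈ antidiagonal k, β (L (a p.1 f)) (a p.2 g) := by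
      simp [Finset.Nat.sum_antidiagonal_succ, hsucc]
    have hright : ∑ p ∈ antidiagonal (k + 1), (p.2 : K) • β (a p.1 f) (a p.2 g) =
        ∑ p ∈ antidiagonal k, β (a p.1 f) (L (a p.2 g)) := by
      simp [Finset.Nat.sum_antidiagonal_succ', hsucc]
    calc (k + 1 : K) • a (k + 1) (β f g)
        = ∑ p ∈ antidiagonal (k + 1), ((p.1 : K) • β (a p.1 f) (a p.2 g) +
            (p.2 : K) • β (a p.1 f) (a p.2 g)) := by
          rw [← hsucc, ih, map_sum, Finset.sum_add_distrib, hleft, hright, ← Finset.sum_add_distrib]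
          exact Finset.sum_congr rfl fun p _ => hL _ _
      _ = (k + 1 : K) • ∑ p ∈ antidiagonal (k + 1), β (a p.1 f) (a p.2 g) := by
          rw [Finset.smul_sum]
          refine Finset.sum_congr rfl fun p hp => ?_
          rw [← add_smul, ← Nat.cast_add, mem_antidiagonal.mp hp,
            Nat.cast_succ]

theorem lieSum_bilinear_sub_mem_fil {β : Series →ₗ[ℝ] Series →ₗ[ℝ] Series}
    (hβ : ∀ p q r, ∀ f ∈ 𝓕 p, ∀ g ∈ 𝓕 q, r + 5 ≤ p + q → β f g ∈ 𝓕 r) (hχ : χ ∈ 𝓕 6)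
    (hL : ∀ f g, lieDeriv χ (β f g) = β (lieDeriv χ f) g + β f (lieDeriv χ g))
    (N : ℕ) (f g : Series) :
    lieSum χ (N + 5) (β f g) - β (lieSum χ (N + 5) f) (lieSum χ (N + 5) g) ∈ 𝓕 N := by
  set a : ℕ → Series → Series := fun k f => (k.factorial : ℝ)⁻¹ • (lieOp χ ^ k) f
  have hsum : ∀ f, lieSum χ (N + 5) f = ∑ k ∈ Finset.range (N + 5), a k f := fun f => by
    rw [lieSum, LinearMap.sum_apply]; rfl
  have ha_mem : ∀ k f, a k f ∈ 𝓕 k := fun k f =>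
    Submodule.smul_of_tower_mem _ _ (by
      simpa using apply_mem_weightIdeal (lieOp_pow_mem_raising (d := 1) hχ k) f)
  have hβ_sum : β (lieSum χ (N + 5) f) (lieSum χ (N + 5) g) =
      ∑ i ∈ Finset.range (N + 5), ∑ j ∈ Finset.range (N + 5), β (a i f) (a j g) := by
    rw [hsum, hsum, LinearMap.map_sum₂]
    exact Finset.sum_congr rfl fun i _ => map_sum _ _ _
  rw [hβ_sum, sum_product_range_eq_sum_antidiagonal_add, hsum,
    Finset.sum_congr rfl fun k _ => pow_bilinear_eq_sum_antidiagonal (L := lieOp χ) hL k f g,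
    sub_add_cancel_left]
  refine neg_mem (sum_mem fun p hp => ?_)
  simp only [Finset.mem_filter, Finset.mem_product, Finset.mem_range, not_lt] at hp
  exact hβ _ _ N _ (ha_mem p.1 f) _ (ha_mem p.2 g) (by omega)

theorem lieExp_bilinear {β : Series →ₗ[ℝ] Series →ₗ[ℝ] Series}
    (hβ : ∀ p q r, ∀ f ∈ 𝓕 p, ∀ g ∈ 𝓕 q, r + 5 ≤ p + q → β f g ∈ 𝓕 r) (hχ : χ ∈ 𝓕 6)
    (hL : ∀ f g, lieDeriv χ (β f g) = β (lieDeriv χ f) g + β f (lieDeriv χ g)) (f g : Series) :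
    lieExp χ (β f g) = β (lieExp χ f) (lieExp χ g) := by
  refine eq_of_forall_sub_mem_fil fun N => ?_
  set S := lieSum χ (N + 5)
  have hE : ∀ f, lieExp χ f - S f ∈ 𝓕 (N + 5) := fun f => by
    simpa using lieExp_sub_lieSum_mem_fil (q := 0) (g := f) hχ (by simp) (N + 5)
  have hsplit : lieExp χ (β f g) - β (lieExp χ f) (lieExp χ g) =
      (lieExp χ (β f g) - S (β f g)) + (S (β f g) - β (S f) (S g))
        - (β (lieExp χ f - S f) (lieExp χ g) + β (S f) (lieExp χ g - S g)) := by
    simp only [map_sub, LinearMap.sub_apply]; abel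
  rw [hsplit]
  exact sub_mem (add_mem (fil_mono (hE _) (by omega)) (lieSum_bilinear_sub_mem_fil hβ hχ hL N f g))
    (add_mem (hβ _ 0 N _ (hE f) _ (by simp) (by omega)) (hβ 0 _ N _ (by simp) _ (hE g) (by omega)))

theorem lieExp_mul (hχ : χ ∈ 𝓕 6) (f g : Series) :
    lieExp χ (f * g) = lieExp χ f * lieExp χ g :=
  lieExp_bilinear (β := LinearMap.mul ℝ Series)
    (fun _ _ _ _ hf _ hg _ => fil_mono (mul_mem_weightIdeal hf hg) (by omega))
    hχ (lieDeriv_mul χ) f g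

theorem lieExp_lieDeriv (hχ : χ ∈ 𝓕 6) (f g : Series) :
    lieExp χ (lieDeriv f g) = lieDeriv (lieExp χ f) (lieExp χ g) :=
  lieExp_bilinear (β := lieOp) (fun _ _ _ _ hf _ hg hr => lieDeriv_mem_fil hf hg hr)
    hχ (lieDeriv_lieDeriv χ) f g

/-- The homomorphism `exp(L_χ)`, defined for Hamiltonians of weight at least `6`. -/
def lieExpHom (χ : Series) (hχ : χ ∈ 𝓕 6) : Series →ₐ[ℝ] Series where
  toFun := lieExp χ
  map_one' := lieExp_eq_of_lieDeriv_eq_zero hχ (by rw [← map_one C, lieDeriv_C])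
  map_mul' := lieExp_mul hχ
  map_zero' := lieExp_eq_of_lieDeriv_eq_zero hχ (map_zero (lieOp χ))
  map_add' := lieExp_add hχ
  commutes' c := lieExp_eq_of_lieDeriv_eq_zero hχ (lieDeriv_C χ c)

/-- `exp(L_χ)` as an operator. -/
def expOp (χ : Series) (hχ : χ ∈ 𝓕 6) : Module.End ℝ Series := (lieExpHom χ hχ).toLinearMap

@[simp] theorem lieExpHom_apply (hχ : χ ∈ 𝓕 6) (f : Series) : lieExpHom χ hχ f = lieExp χ f := rfl

@[simp] theorem expOp_apply (hχ : χ ∈ 𝓕 6) (f : Series) : expOp χ hχ f = lieExp χ f := rfl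

theorem expOp_sub_lieSum_mem_raising (hχ : χ ∈ 𝓕 6) (N : ℕ) : expOp χ hχ - lieSum χ N ∈ 𝓡 N :=
  fun _ _ hg => lieExp_sub_lieSum_mem_fil hχ hg N

theorem lieSum_add_two (χ : Series) (N : ℕ) :
    lieSum χ (N + 2) = 1 + lieOp χ +
      ∑ k ∈ Finset.range N, ((k + 2).factorial : ℝ)⁻¹ • lieOp χ ^ (k + 2) := by
  rw [lieSum, Finset.sum_range_succ', Finset.sum_range_succ']
  simp only [zero_add, pow_zero, pow_one, Nat.factorial_zero, Nat.factorial_one, Nat.cast_one,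
    inv_one, one_smul]
  abel

theorem expOp_sub_one_sub_lieOp_mem_raising (hχ : χ ∈ 𝓕 6) (h : χ ∈ 𝓕 (d + 5)) :
    expOp χ hχ - 1 - lieOp χ ∈ 𝓡 (2 * d) := by
  have hterm : ∀ k, lieOp χ ^ (k + 2) ∈ 𝓡 (2 * d) := fun k =>
    raising_mono (lieOp_pow_mem_raising h (k + 2)) (Nat.mul_le_mul_right d (by omega))
  have hrest := raising_mono (expOp_sub_lieSum_mem_raising hχ (2 * d + 2)) (Nat.le_add_right _ 2)
  rw [lieSum_add_two] at hrest
  have := add_mem hrest (sum_mem fun k (_ : k ∈ Finset.range (2 * d)) =>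
    Submodule.smul_mem _ ((k + 2).factorial : ℝ)⁻¹ (hterm k))
  convert this using 1
  abel

theorem expOp_sub_one_mem_raising (hχ : χ ∈ 𝓕 6) (h : χ ∈ 𝓕 (d + 5)) : expOp χ hχ - 1 ∈ 𝓡 d := by
  simpa using add_mem (raising_mono (expOp_sub_one_sub_lieOp_mem_raising hχ h) (by omega))
    (lieOp_mem_raising h)

theorem lieOp_add_pow_sub_pow_mem_raising (hχ : χ ∈ 𝓕 6) (hη : η ∈ 𝓕 (d + 5))
    (hχη : χ + η ∈ 𝓕 6) (k : ℕ) : lieOp (χ + η) ^ (k + 1) - lieOp χ ^ (k + 1) ∈ 𝓡 (d + k) := by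
  induction k with
  | zero => simpa using lieOp_mem_raising hη
  | succ k ih =>
    have hsplit : lieOp (χ + η) ^ (k + 1 + 1) - lieOp χ ^ (k + 1 + 1) =
        (lieOp (χ + η) ^ (k + 1) - lieOp χ ^ (k + 1)) * lieOp (χ + η)
          + lieOp χ ^ (k + 1) * lieOp η := by
      rw [pow_succ (lieOp (χ + η)) (k + 1), pow_succ (lieOp χ) (k + 1), sub_mul, map_add, mul_add,
        mul_add]
      abel
    rw [hsplit]
    exact add_mem (mul_mem_raising (e := 1) ih (lieOp_mem_raising hχη))
      (raising_mono (mul_mem_raising (lieOp_pow_mem_raising (d := 1) hχ (k + 1))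
        (lieOp_mem_raising hη)) (by omega))

theorem expOp_add_sub_expOp_sub_lieOp_mem_raising (hχ : χ ∈ 𝓕 6) (hη : η ∈ 𝓕 (d + 5))
    (hχη : χ + η ∈ 𝓕 6) : expOp (χ + η) hχη - expOp χ hχ - lieOp η ∈ 𝓡 (d + 1) := by
  have hrest : ∀ ζ (hζ : ζ ∈ 𝓕 6), expOp ζ hζ - lieSum ζ (d + 2) ∈ 𝓡 (d + 1) := fun ζ hζ =>
    raising_mono (expOp_sub_lieSum_mem_raising hζ (d + 2)) (by omega)
  have hsum : ∑ k ∈ Finset.range d, ((k + 2).factorial : ℝ)⁻¹ •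
      (lieOp (χ + η) ^ (k + 2) - lieOp χ ^ (k + 2)) ∈ 𝓡 (d + 1) :=
    sum_mem fun k _ => Submodule.smul_mem _ _
      (raising_mono (lieOp_add_pow_sub_pow_mem_raising hχ hη hχη (k + 1)) (by omega))
  convert add_mem (sub_mem (hrest _ hχη) (hrest _ hχ)) hsum using 1
  rw [lieSum_add_two, lieSum_add_two]
  simp only [smul_sub, Finset.sum_sub_distrib, map_add]
  abel

theorem algHom_mul_lieOp {A : Series →ₐ[ℝ] Series}
    (hA : ∀ f g, lieDeriv (A f) (A g) = A (lieDeriv f g)) (χ : Series) :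
    A.toLinearMap * lieOp χ = lieOp (A χ) * A.toLinearMap :=
  LinearMap.ext fun g => (hA χ g).symm

theorem algHom_mul_expOp {A : Series →ₐ[ℝ] Series} (hA0 : A.toLinearMap ∈ 𝓡 0)
    (hA : ∀ f g, lieDeriv (A f) (A g) = A (lieDeriv f g)) (hχ : χ ∈ 𝓕 6) (hAχ : A χ ∈ 𝓕 6) :
    A.toLinearMap * expOp χ hχ = expOp (A χ) hAχ * A.toLinearMap := by
  refine eq_of_forall_sub_mem_raising fun N => ?_
  have hpow : ∀ k, A.toLinearMap * lieOp χ ^ k = lieOp (A χ) ^ k * A.toLinearMap := fun k =>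
    (SemiconjBy.pow_right (algHom_mul_lieOp hA χ) k)
  have hsum : A.toLinearMap * lieSum χ N = lieSum (A χ) N * A.toLinearMap := by
    simp only [lieSum, Finset.mul_sum, Finset.sum_mul, mul_smul_comm, smul_mul_assoc, hpow]
  have h := sub_mem (raising_mono (mul_mem_raising hA0 (expOp_sub_lieSum_mem_raising hχ N))
      (Nat.le_add_left N 0))
    (mul_mem_raising (expOp_sub_lieSum_mem_raising hAχ N) hA0)
  convert h using 1
  rw [mul_sub, sub_mul, hsum]
  abel

end LieSeries

/-! ### Automorphisms close to the identity -/

/-- A homomorphism which fixes `ε`, preserves the Poisson bracket and is the identity in the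
lowest order of the weight filtration. -/
structure IsNearIdentity (A : Series →ₐ[ℝ] Series) : Prop where
  eps : A (X 2) = X 2
  sub_one_mem_raising : A.toLinearMap - 1 ∈ 𝓡 1
  poisson : ∀ f g, lieDeriv (A f) (A g) = A (lieDeriv f g)

theorem exists_hamiltonian_of_divergence {a b : Series} {d : ℕ} (ha : a ∈ 𝓕 (d + 2))
    (hb : b ∈ 𝓕 (d + 3)) (hdiv : dx a + dy b ∈ 𝓕 (d + 1)) :
    ∃ g ∈ 𝓕 (d + 5), dy g = a ∧ b + dx g ∈ 𝓕 (d + 4) := by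
  have hPx {f : Series} {q} (hf : f ∈ 𝓕 q) : primitive 0 f ∈ 𝓕 (q + 2) :=
    primitive_mem_weightIdeal hf 0
  have hPy {f : Series} {q} (hf : f ∈ 𝓕 q) : primitive 1 f ∈ 𝓕 (q + 3) :=
    primitive_mem_weightIdeal hf 1
  -- `b + ∂ₓ g` reduces to the `y`-primitive of the divergence once its part free of `y` is
  -- removed by a primitive in `x`.
  set r := b + dx (primitive 1 a) - primitive 1 (dx a + dy b) with hr
  have hdy_r : dy r = 0 := by
    have h₁ : dy (dx (primitive 1 a)) = dx a := by
      rw [← dx_dy]; exact congrArg dx (pderiv_primitive 1 a)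
    have h₂ : dy (primitive 1 (dx a + dy b)) = dx a + dy b := pderiv_primitive 1 _
    rw [hr, dy_sub, dy_add, h₁, h₂]; ring
  have hdy_primitive : dy (primitive 0 r) = 0 := by
    have h : dy (primitive 0 r) = primitive 0 (dy r) := pderiv_primitive_of_ne (by decide) r
    rw [h, hdy_r, primitive_zero]
  have hr_mem : r ∈ 𝓕 (d + 3) :=
    sub_mem (add_mem hb (dx_mem_fil (hPy ha))) (fil_mono (hPy hdiv) (by omega))
  refine ⟨primitive 1 a - primitive 0 r, sub_mem (hPy ha) (hPx hr_mem), ?_, ?_⟩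
  · rw [dy_sub, hdy_primitive, sub_zero]
    exact pderiv_primitive 1 a
  · have h : b + dx (primitive 1 a - primitive 0 r) = primitive 1 (dx a + dy b) := by
      have : dx (primitive 0 r) = r := pderiv_primitive 0 r
      rw [dx_sub, this, hr]; ring
    rw [h]
    exact hPy hdiv

namespace IsNearIdentity

variable {A B : Series →ₐ[ℝ] Series} {χ g : Series} {d : ℕ}

theorem mem_raising_zero (hA : IsNearIdentity A) : A.toLinearMap ∈ 𝓡 0 := by
  simpa using add_mem (raising_mono hA.sub_one_mem_raising (Nat.zero_le _)) one_mem_raising_zero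

theorem X_mem_fil (hA : IsNearIdentity A) (i : Fin 3) : A (X i) ∈ 𝓕 (varWeight i) :=
  hA.mem_raising_zero _ _ (X_mem_weightIdeal i)

theorem X_sub_mem_fil (hA : IsNearIdentity A) (i : Fin 3) : A (X i) - X i ∈ 𝓕 (varWeight i + 1) :=
  hA.sub_one_mem_raising _ _ (X_mem_weightIdeal i)

theorem constantCoeff_X (hA : IsNearIdentity A) (i : Fin 3) : constantCoeff (A (X i)) = 0 :=
  mem_fil_one.mp (fil_mono (hA.X_mem_fil i) (varWeight_pos i))

protected theorem id : IsNearIdentity (AlgHom.id ℝ Series) where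
  eps := rfl
  sub_one_mem_raising := by
    have : (AlgHom.id ℝ Series).toLinearMap - 1 = 0 := sub_self _
    rw [this]; exact zero_mem _
  poisson _ _ := rfl

theorem comp (hA : IsNearIdentity A) (hB : IsNearIdentity B) : IsNearIdentity (A.comp B) where
  eps := by rw [AlgHom.comp_apply, hB.eps, hA.eps]
  sub_one_mem_raising := by
    have h : (A.comp B).toLinearMap - 1 =
        A.toLinearMap * (B.toLinearMap - 1) + (A.toLinearMap - 1) := by
      rw [mul_sub, mul_one, sub_add_sub_cancel]; rfl
    rw [h]
    exact add_mem (raising_mono (mul_mem_raising hA.mem_raising_zero hB.sub_one_mem_raising)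
      (by omega)) hA.sub_one_mem_raising
  poisson f g := by
    simp only [AlgHom.comp_apply]
    rw [hA.poisson, hB.poisson]

theorem lieExpHom (hχ : χ ∈ 𝓕 6) : IsNearIdentity (lieExpHom χ hχ) where
  eps := lieExp_eq_of_lieDeriv_eq_zero hχ (lieDeriv_X_two χ)
  sub_one_mem_raising := expOp_sub_one_mem_raising hχ hχ
  poisson f g := (lieExp_lieDeriv hχ f g).symm

theorem of_X (hε : A (X 2) = X 2) (h0 : A (X 0) - X 0 ∈ 𝓕 3) (h1 : A (X 1) - X 1 ∈ 𝓕 4)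
    (hJ : lieDeriv (A (X 1)) (A (X 0)) = 1) : IsNearIdentity A := by
  have hX : ∀ i, A (X i) - X i ∈ 𝓕 (varWeight i + 1) := by
    intro i
    fin_cases i
    · exact h0
    · exact h1
    · simp [hε]
  have hX_mem : ∀ i, A (X i) ∈ 𝓕 (varWeight i) := fun i => by
    simpa using add_mem (fil_mono (hX i) (by omega)) (X_mem_weightIdeal i)
  refine ⟨hε, ?_, fun f g => ?_⟩
  · exact algHom_sub_mem_raising (B := AlgHom.id ℝ Series) varWeight_pos
      (algHom_mem_raising_zero varWeight_pos hX_mem) X_mem_weightIdeal hX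
  · have h0 : ∀ i, constantCoeff (A (X i)) = 0 := fun i =>
      mem_fil_one.mp (fil_mono (hX_mem i) (varWeight_pos i))
    rw [lieDeriv_algHom h0 hε, hJ, mul_one]

theorem bijective (hA : IsNearIdentity A) : Function.Bijective A :=
  (Module.End.isUnit_iff _).mp (isUnit_of_sub_one_mem_raising hA.sub_one_mem_raising)

theorem sub_sub_lieOp_mem_raising (hA : IsNearIdentity A) (hB : IsNearIdentity B)
    (h : A.toLinearMap - B.toLinearMap ∈ 𝓡 d) (hg : g ∈ 𝓕 (d + 5))
    (h0 : A (X 0) - B (X 0) - dy g ∈ 𝓕 (d + 3)) (h1 : A (X 1) - B (X 1) + dx g ∈ 𝓕 (d + 4)) :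
    A.toLinearMap - B.toLinearMap - lieOp g ∈ 𝓡 (d + 1) := by
  have hX : ∀ i, A (X i) - B (X i) - lieOp g (X i) ∈ 𝓕 (varWeight i + d + 1) := by
    intro i
    fin_cases i
    · exact fil_mono (by simpa using h0) (by simp [varWeight]; omega)
    · exact fil_mono (by simpa using h1) (by simp [varWeight]; omega)
    · simp [hA.eps, hB.eps]
  refine mem_raising_of_X varWeight_pos X_mem_weightIdeal (by simp [algHom_C]) fun i q f hf => ?_
  have hleibniz : (A.toLinearMap - B.toLinearMap - lieOp g) (X i * f)
        - X i * (A.toLinearMap - B.toLinearMap - lieOp g) f =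
      (A (X i) - B (X i) - lieOp g (X i)) * A f + lieOp g (X i) * (A.toLinearMap - 1) f
        + (B (X i) - X i) * (A.toLinearMap - B.toLinearMap) f := by
    simp only [LinearMap.sub_apply, AlgHom.toLinearMap_apply, map_mul, lieOp_apply,
      lieDeriv_mul, Module.End.one_apply]
    ring
  have hgX := lieOp_mem_raising hg _ _ (X_mem_weightIdeal i)
  rw [hleibniz]
  exact add_mem (add_mem
    (fil_mono (mul_mem_weightIdeal (hX i) (hA.mem_raising_zero _ _ hf)) (by omega))
    (fil_mono (mul_mem_weightIdeal hgX (hA.sub_one_mem_raising _ _ hf)) (by omega)))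
    (fil_mono (mul_mem_weightIdeal (hB.X_sub_mem_fil i) (h _ _ hf)) (by omega))

theorem divergence_mem_fil (hA : IsNearIdentity A) (hB : IsNearIdentity B)
    (h : A.toLinearMap - B.toLinearMap ∈ 𝓡 d) :
    dx (A (X 0) - B (X 0)) + dy (A (X 1) - B (X 1)) ∈ 𝓕 (d + 1) := by
  have hdet {T} (hT : IsNearIdentity T) : lieDeriv (T (X 1)) (T (X 0)) = 1 := by
    rw [hT.poisson]; simp
  have hbilin : dx (A (X 0) - B (X 0)) + dy (A (X 1) - B (X 1)) =
      (lieDeriv (A (X 1)) (A (X 0)) - lieDeriv (B (X 1)) (B (X 0)))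
        - (lieDeriv (A (X 1) - B (X 1)) (A (X 0) - X 0)
          + lieDeriv (B (X 1) - X 1) (A (X 0) - B (X 0))) := by
    simp only [lieDeriv, dx_sub, dy_sub, dx_X_zero, dx_X_one, dy_X_zero, dy_X_one]
    ring
  rw [hbilin, hdet hA, hdet hB, sub_self, zero_sub]
  refine neg_mem (add_mem ?_ ?_)
  · exact lieDeriv_mem_fil (h _ _ (X_mem_weightIdeal 1)) (hA.X_sub_mem_fil 0)
      (by simp [varWeight]; omega)
  · exact lieDeriv_mem_fil (hB.X_sub_mem_fil 1) (h _ _ (X_mem_weightIdeal 0))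
      (by simp [varWeight]; omega)

theorem exists_hamiltonian (hA : IsNearIdentity A) (hB : IsNearIdentity B)
    (h : A.toLinearMap - B.toLinearMap ∈ 𝓡 d) :
    ∃ g ∈ 𝓕 (d + 5), A.toLinearMap - B.toLinearMap - lieOp g ∈ 𝓡 (d + 1) := by
  obtain ⟨g, hg, hdy, hdx⟩ := exists_hamiltonian_of_divergence
    (fil_mono (h _ _ (X_mem_weightIdeal 0)) (by simp [varWeight]; omega))
    (fil_mono (h _ _ (X_mem_weightIdeal 1)) (by simp [varWeight]; omega))
    (hA.divergence_mem_fil hB h)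
  refine ⟨g, hg, hA.sub_sub_lieOp_mem_raising hB h hg ?_ hdx⟩
  simp [hdy]

theorem exists_limit {A : ℕ → Series →ₐ[ℝ] Series} (hA : ∀ k, IsNearIdentity (A k))
    (h : ∀ k, (A (k + 1)).toLinearMap - (A k).toLinearMap ∈ 𝓡 (k + 1)) :
    ∃ L, IsNearIdentity L ∧ ∀ k, L.toLinearMap - (A k).toLinearMap ∈ 𝓡 (k + 1) := by
  obtain ⟨L, hL⟩ := exists_algHom_sub_mem_raising h
  have hLA : ∀ k f, L f - A k f ∈ 𝓕 k := fun k f =>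
    fil_mono (apply_mem_weightIdeal (hL k) f) k.le_succ
  refine ⟨L, ⟨?_, ?_, fun f g => ?_⟩, hL⟩
  · exact eq_of_forall_sub_mem_fil fun k => by simpa [(hA k).eps] using hLA k (X 2)
  · simpa using add_mem (hL 0) (hA 0).sub_one_mem_raising
  · refine eq_of_forall_sub_mem_fil fun N => ?_
    have hf := hLA (N + 5) f
    have hg := hLA (N + 5) g
    have hfg := hLA (N + 5) (lieDeriv f g)
    have hsplit : lieDeriv (L f) (L g) - L (lieDeriv f g) =
        lieDeriv (L f - A (N + 5) f) (L g) + lieDeriv (A (N + 5) f) (L g - A (N + 5) g)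
          - (L (lieDeriv f g) - A (N + 5) (lieDeriv f g)) := by
      rw [← (hA (N + 5)).poisson]
      simp only [lieDeriv, dx_sub, dy_sub]; ring
    rw [hsplit]
    exact sub_mem (add_mem (lieDeriv_mem_fil (q := 0) hf (by simp) (by omega))
      (lieDeriv_mem_fil (p := 0) (by simp) hg (by omega))) (fil_mono hfg (by omega))

end IsNearIdentity

/-! ### Formal maps and the reflection -/

theorem lieOp_mem_raising_iff {f : Series} {d : ℕ} :
    lieOp f ∈ 𝓡 d ↔ ∀ n, weight n < d + 5 → n 0 ≠ 0 ∨ n 1 ≠ 0 → coeff n f = 0 := by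
  constructor
  · intro h n hn h01
    have hdy : dy f ∈ 𝓕 (2 + d) := by simpa [varWeight] using h _ _ (X_mem_weightIdeal 0)
    have hdx : dx f ∈ 𝓕 (3 + d) := by simpa [varWeight] using h _ _ (X_mem_weightIdeal 1)
    rw [← weight_varWeight] at hn
    rcases h01 with h0 | h1
    · exact coeff_eq_zero_of_pderiv_mem_weightIdeal hdx h0
        (lt_of_lt_of_eq hn (show d + 5 = 3 + d + 2 by ring))
    · exact coeff_eq_zero_of_pderiv_mem_weightIdeal hdy h1
        (lt_of_lt_of_eq hn (show d + 5 = 2 + d + 3 by ring))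
  · intro h
    have hdx : dx f ∈ 𝓕 (d + 3) := mem_fil.mpr fun n hn => by
      rw [coeff_dx, h _ (by simp [weight_add, varWeight]; omega) (by simp), zero_mul]
    have hdy : dy f ∈ 𝓕 (d + 2) := mem_fil.mpr fun n hn => by
      rw [coeff_dy, h _ (by simp [weight_add, varWeight]; omega) (by simp), zero_mul]
    exact fun q g hg => sub_mem
      (fil_mono (mul_mem_weightIdeal (dx_mem_fil hg) hdy) (by omega))
      (fil_mono (mul_mem_weightIdeal (dy_mem_fil hg) hdx) (by omega))

section FormalMaps

variable {F G H : FormalMap} {A : Series →ₐ[ℝ] Series}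

theorem hasSubst_of_fixesOrigin (hG : FixesOrigin G) :
    HasSubst (![G 0, G 1, X 2] : Fin 3 → Series) :=
  hasSubst_of_constantCoeff_zero (by intro i; fin_cases i <;> simp [hG 0, hG 1])

/-- The pullback `f ↦ f ∘ G`. -/
def pull (G : FormalMap) (hG : FixesOrigin G) : Series →ₐ[ℝ] Series :=
  substAlgHom (hasSubst_of_fixesOrigin hG)

@[simp] theorem pull_X_zero (hG : FixesOrigin G) : pull G hG (X 0) = G 0 := by
  rw [pull, substAlgHom_X]; rfl

@[simp] theorem pull_X_one (hG : FixesOrigin G) : pull G hG (X 1) = G 1 := by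
  rw [pull, substAlgHom_X]; rfl

@[simp] theorem pull_X_two (hG : FixesOrigin G) : pull G hG (X 2) = X 2 := by
  rw [pull, substAlgHom_X]; rfl

theorem constantCoeff_pull_X (hG : FixesOrigin G) (i : Fin 3) :
    constantCoeff (pull G hG (X i)) = 0 := by
  fin_cases i
  · simpa using hG 0
  · simpa using hG 1
  · simp

theorem comp_eq_pull (hG : FixesOrigin G) (F : FormalMap) :
    comp F G = fun i => pull G hG (F i) := by
  funext i; rw [comp, pull, coe_substAlgHom]

theorem fixesOrigin_comp (hG : FixesOrigin G) (hH : FixesOrigin H) : FixesOrigin (comp G H) := by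
  intro i
  rw [comp_eq_pull hH, constantCoeff_algHom (constantCoeff_pull_X hH), hG i]

theorem pull_comp (hG : FixesOrigin G) (hH : FixesOrigin H) (hGH : FixesOrigin (comp G H)) :
    pull (comp G H) hGH = (pull H hH).comp (pull G hG) := by
  refine algHom_ext (constantCoeff_pull_X _) fun i => ?_
  fin_cases i <;> simp [comp_eq_pull hH]

/-- The map with components `A x`, `A y`. -/
def toMap (A : Series →ₐ[ℝ] Series) : FormalMap := ![A (X 0), A (X 1)]

theorem pull_toMap (hε : A (X 2) = X 2) (h : FixesOrigin (toMap A)) : pull (toMap A) h = A := by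
  refine algHom_ext (constantCoeff_pull_X _) fun i => ?_
  fin_cases i <;> simp [toMap, hε]

theorem fixesOrigin_toMap (hA : ∀ i, constantCoeff (A (X i)) = 0) : FixesOrigin (toMap A) :=
  Fin.forall_fin_two.mpr ⟨hA 0, hA 1⟩

theorem comp_assoc (hG : FixesOrigin G) (hH : FixesOrigin H) :
    comp (comp F G) H = comp F (comp G H) := by
  rw [comp_eq_pull (fixesOrigin_comp hG hH), comp_eq_pull hH, comp_eq_pull hG]
  funext i
  rw [pull_comp hG hH]; rfl

theorem comp_idMap (F : FormalMap) : comp F idMap = F := by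
  funext i
  have : (![idMap 0, idMap 1, X 2] : Fin 3 → Series) = X := by
    funext i; fin_cases i <;> rfl
  rw [comp, this, subst_self]; rfl

theorem idMap_comp (hG : FixesOrigin G) : comp idMap G = G := by
  rw [comp_eq_pull hG]
  funext i
  fin_cases i <;> simp [idMap]

theorem jacobianDet_eq_lieDeriv (G : FormalMap) : jacobianDet G = lieDeriv (G 1) (G 0) := rfl

theorem jacobianDet_comp (hH : FixesOrigin H) :
    jacobianDet (comp G H) = pull H hH (jacobianDet G) * jacobianDet H := by
  rw [comp_eq_pull hH, jacobianDet_eq_lieDeriv, lieDeriv_algHom (constantCoeff_pull_X hH)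
    (pull_X_two hH), pull_X_zero, pull_X_one]
  rfl

theorem IsAreaPreserving.comp (hG : IsAreaPreserving G) (hH : IsAreaPreserving H)
    (h : FixesOrigin H) : IsAreaPreserving (comp G H) := by
  unfold IsAreaPreserving
  rw [jacobianDet_comp h]
  rcases hG with hG | hG <;> rcases hH with hH | hH <;> simp [hG, hH]

end FormalMaps

section Reflection

variable {A : Series →ₐ[ℝ] Series} {T : Module.End ℝ Series} {χ : Series} {d : ℕ}

/-- The pullback by `(x, y) ↦ (-x, -y)`. -/
def refl : Series →ₐ[ℝ] Series := rescaleAlgHom ![-1, -1, 1]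

theorem coeff_refl (f : Series) (n : Fin 3 →₀ ℕ) :
    coeff n (refl f) = (-1) ^ (n 0 + n 1) * coeff n f := by
  rw [refl, rescaleAlgHom_apply, coeff_rescale, Finsupp.prod_fintype _ _ (by simp)]
  simp [Fin.prod_univ_three, pow_add]

theorem refl_X (i : Fin 3) : refl (X i) = (![-1, -1, 1] : Fin 3 → ℝ) i • X i := by
  rw [refl, rescaleAlgHom, substAlgHom_X]; rfl

@[simp] theorem refl_X_zero : refl (X 0) = -X 0 := by rw [refl_X]; simp
@[simp] theorem refl_X_one : refl (X 1) = -X 1 := by rw [refl_X]; simp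
@[simp] theorem refl_X_two : refl (X 2) = X 2 := by rw [refl_X]; simp

theorem constantCoeff_refl_X (i : Fin 3) : constantCoeff (refl (X i)) = 0 := by
  fin_cases i <;> simp

@[simp] theorem refl_refl (f : Series) : refl (refl f) = f := by
  ext n
  rw [coeff_refl, coeff_refl, ← mul_assoc, ← mul_pow]
  simp

theorem refl_poisson (f g : Series) : lieDeriv (refl f) (refl g) = refl (lieDeriv f g) := by
  rw [lieDeriv_algHom constantCoeff_refl_X refl_X_two]
  simp [lieDeriv]

theorem refl_mem_raising_zero : refl.toLinearMap ∈ 𝓡 0 :=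
  algHom_mem_raising_zero varWeight_pos fun i =>
    refl_X i ▸ Submodule.smul_of_tower_mem _ _ (X_mem_weightIdeal i)

/-- The reflection `refl` as an automorphism. -/
def reflEquiv : Series ≃ₐ[ℝ] Series :=
  AlgEquiv.ofAlgHom refl refl (AlgHom.ext refl_refl) (AlgHom.ext refl_refl)

/-- The conjugation `T ↦ refl ∘ T ∘ refl` of operators. -/
def conj : Module.End ℝ Series ≃ₐ[ℝ] Module.End ℝ Series :=
  reflEquiv.toLinearEquiv.conjAlgEquiv ℝ

theorem conj_eq_mul (T : Module.End ℝ Series) :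
    conj T = refl.toLinearMap * T * refl.toLinearMap := rfl

@[simp] theorem conj_conj (T : Module.End ℝ Series) : conj (conj T) = T := by
  ext1 f
  simp [conj_eq_mul]

theorem conj_mem_raising (hT : T ∈ 𝓡 d) : conj T ∈ 𝓡 d := by
  have h := mul_mem_raising (mul_mem_raising refl_mem_raising_zero hT) refl_mem_raising_zero
  rwa [zero_add, add_zero, ← conj_eq_mul] at h

theorem conj_eq_of_mul_eq {T U : Module.End ℝ Series}
    (h : refl.toLinearMap * T = U * refl.toLinearMap) : conj T = U := by
  rw [conj_eq_mul, h]
  ext1 f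
  simp

theorem conj_lieOp (χ : Series) : conj (lieOp χ) = lieOp (refl χ) :=
  conj_eq_of_mul_eq (algHom_mul_lieOp refl_poisson χ)

theorem conj_expOp (hχ : χ ∈ 𝓕 6) (h : refl χ ∈ 𝓕 6) :
    conj (expOp χ hχ) = expOp (refl χ) h :=
  conj_eq_of_mul_eq (algHom_mul_expOp refl_mem_raising_zero refl_poisson hχ h)

theorem IsNearIdentity.conj (hA : IsNearIdentity A) :
    IsNearIdentity (refl.comp (A.comp refl)) where
  eps := by simp [hA.eps]
  sub_one_mem_raising := by
    have h : (refl.comp (A.comp refl)).toLinearMap - 1 =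
        AreaPreservingNF.conj (A.toLinearMap - 1) := by
      rw [map_sub, map_one]; rfl
    rw [h]; exact conj_mem_raising hA.sub_one_mem_raising
  poisson f g := by simp only [AlgHom.comp_apply, refl_poisson, hA.poisson]

end Reflection

/-! ### Hamiltonians in normal form -/

section NormalForm

variable {u v : ℕ → ℕ → ℝ} {d : ℕ}

/-- The leading part `y² / 2` of the Hamiltonians in normal form. -/
def kinetic : Series := C (1 / 2 : ℝ) * X 1 ^ 2

theorem coeff_kinetic (n : Fin 3 →₀ ℕ) :
    coeff n kinetic = if n = Finsupp.single 1 2 then 1 / 2 else 0 := by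
  classical
  rw [kinetic, coeff_C_mul, coeff_X_pow, mul_ite, mul_one, mul_zero]

theorem kinetic_mem_fil : kinetic ∈ 𝓕 6 :=
  Ideal.mul_mem_left _ _ (pow_mem_weightIdeal (X_mem_weightIdeal 1) 2)

theorem two_smul_kinetic : (2 : ℝ) • kinetic = X 1 ^ 2 := by
  rw [kinetic, smul_eq_C_mul, ← mul_assoc, ← map_mul]
  norm_num

theorem dx_kinetic : dx kinetic = 0 := by
  rw [kinetic, dx_mul, sq, dx_mul, dx_X_one, dx_C]
  ring

theorem dy_kinetic : dy kinetic = X 1 := by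
  have h := congrArg dy two_smul_kinetic
  rw [dy_smul, sq, dy_mul, dy_X_one, one_mul, mul_one, ← two_smul ℝ] at h
  exact smul_right_injective _ two_ne_zero h

theorem lieDeriv_kinetic (g : Series) : lieDeriv g kinetic = -(X 1 * dx g) := by
  rw [lieDeriv, dx_kinetic, dy_kinetic, zero_mul, zero_sub]

@[simp] theorem refl_kinetic : refl kinetic = kinetic := by
  rw [kinetic, map_mul, algHom_C, map_pow, refl_X_one, neg_sq]

theorem normalHam_eq (u : ℕ → ℕ → ℝ) : normalHam u = kinetic + potential u := rfl

theorem coeff_potential (u : ℕ → ℕ → ℝ) (n : Fin 3 →₀ ℕ) : coeff n (potential u) =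
    if Even (n 0) ∧ n 1 = 0 ∧ 2 ≤ n 0 / 2 + 2 * n 2 then u (n 0 / 2) (n 2) else 0 := rfl

theorem coeff_potential_of_le (u : ℕ → ℕ → ℝ) {k m : ℕ} (h : 2 ≤ k + 2 * m) :
    coeff (Finsupp.single 0 (2 * k) + Finsupp.single 2 m) (potential u) = u k m := by
  rw [coeff_potential]
  simp [h]

theorem potential_add (u v : ℕ → ℕ → ℝ) : potential (u + v) = potential u + potential v := by
  ext n
  rw [map_add, coeff_potential, coeff_potential, coeff_potential]
  split_ifs <;> simp

theorem coeff_potential_eq_zero (hu : ∀ m, u 0 m = 0) {n : Fin 3 →₀ ℕ} (h : n 0 = 0 ∨ n 1 ≠ 0) :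
    coeff n (potential u) = 0 := by
  rw [coeff_potential]
  rcases h with h0 | h1
  · simp [h0, hu]
  · simp [h1]

@[simp] theorem refl_potential (u : ℕ → ℕ → ℝ) : refl (potential u) = potential u := by
  ext n
  rw [coeff_refl, coeff_potential]
  split_ifs with h
  · rw [h.2.1, add_zero, h.1.neg_one_pow, one_mul]
  · rw [mul_zero]

@[simp] theorem refl_normalHam (u : ℕ → ℕ → ℝ) : refl (normalHam u) = normalHam u := by
  rw [normalHam_eq, map_add, refl_kinetic, refl_potential]

theorem normalHam_mem_fil (u : ℕ → ℕ → ℝ) : normalHam u ∈ 𝓕 6 :=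
  mem_fil.mpr (coeff_normalHam_eq_zero u)

theorem potential_mem_fil (hu : ∀ m, u 0 m = 0) : potential u ∈ 𝓕 8 :=
  mem_fil.mpr fun n hn => by
    rw [coeff_potential]
    refine ite_eq_right_iff.mpr fun h => ?_
    have h0 : n 0 / 2 = 0 := by
      unfold weight at hn
      have := Nat.div_add_mod (n 0) 2
      omega
    rw [h0, hu]

/-- The operator `exp(L_h)` of the Hamiltonian `h` in normal form with coefficients `u`. -/
def normalExp (u : ℕ → ℕ → ℝ) : Module.End ℝ Series := expOp (normalHam u) (normalHam_mem_fil u)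

theorem conj_normalExp (u : ℕ → ℕ → ℝ) : conj (normalExp u) = normalExp u := by
  have h := conj_expOp (normalHam_mem_fil u) (by rw [refl_normalHam]; exact normalHam_mem_fil u)
  simp only [refl_normalHam] at h
  exact h

theorem normalExp_sub_one_mem_raising (u : ℕ → ℕ → ℝ) : normalExp u - 1 ∈ 𝓡 1 :=
  expOp_sub_one_mem_raising _ (normalHam_mem_fil u)

theorem isNearIdentity_normalExp (u : ℕ → ℕ → ℝ) :
    IsNearIdentity (lieExpHom (normalHam u) (normalHam_mem_fil u)) :=
  .lieExpHom _

theorem normalExp_mem_raising_zero (u : ℕ → ℕ → ℝ) : normalExp u ∈ 𝓡 0 :=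
  (isNearIdentity_normalExp u).mem_raising_zero

theorem normalExp_sub_one_sub_lieOp_kinetic_mem_raising (hu : ∀ m, u 0 m = 0) :
    normalExp u - 1 - lieOp kinetic ∈ 𝓡 2 := by
  have hpot : lieOp (potential u) ∈ 𝓡 2 :=
    lieOp_mem_raising (fil_mono (potential_mem_fil hu) (by omega))
  convert add_mem (expOp_sub_one_sub_lieOp_mem_raising (d := 1) (normalHam_mem_fil u)
    (normalHam_mem_fil u)) hpot using 1
  have hsum : lieOp (normalHam u) = lieOp kinetic + lieOp (potential u) := map_add _ _ _
  rw [normalExp, hsum]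
  abel

theorem normalExp_sub_sub_lieOp_mem_raising (h : potential v - potential u ∈ 𝓕 (d + 5)) :
    normalExp v - normalExp u - lieOp (potential v - potential u) ∈ 𝓡 (d + 1) := by
  have hv : normalHam v = normalHam u + (potential v - potential u) := by
    simp only [normalHam_eq]; abel
  have := expOp_add_sub_expOp_sub_lieOp_mem_raising (normalHam_mem_fil u) h
    (hv ▸ normalHam_mem_fil v)
  simp only [← hv] at this
  exact this

theorem normalExp_sub_mem_raising (h : potential v - potential u ∈ 𝓕 (d + 5)) :
    normalExp v - normalExp u ∈ 𝓡 d := by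
  simpa using add_mem (raising_mono (normalExp_sub_sub_lieOp_mem_raising h) (Nat.le_add_right d 1))
    (lieOp_mem_raising h)

theorem timeOne_normalHam_congr (h : ∀ k m, k ≠ 0 → u k m = v k m) :
    timeOne (normalHam u) = timeOne (normalHam v) := by
  have hop : lieOp (normalHam u) = lieOp (normalHam v) := by
    refine eq_of_forall_sub_mem_raising fun N => ?_
    rw [← map_sub, lieOp_mem_raising_iff, normalHam_eq, normalHam_eq, add_sub_add_left_eq_sub]
    intro n _ h01
    rw [map_sub, coeff_potential, coeff_potential, sub_eq_zero]
    refine if_ctx_congr Iff.rfl (fun hn => h _ _ ?_) fun _ => rfl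
    obtain ⟨⟨a, ha⟩, h1, -⟩ := hn
    omega
  have hexp : lieExp (normalHam u) = lieExp (normalHam v) := by
    funext g n
    simp only [lieExp, iterate_lieDeriv, hop]
  rw [timeOne, timeOne, hexp]

/-- The pullback by the map `-Φ¹_h` in normal form with coefficients `u`. -/
def normalHom (u : ℕ → ℕ → ℝ) : Series →ₐ[ℝ] Series :=
  (lieExpHom (normalHam u) (normalHam_mem_fil u)).comp refl

theorem normalHom_X_two (u : ℕ → ℕ → ℝ) : normalHom u (X 2) = X 2 := by
  rw [normalHom, AlgHom.comp_apply, refl_X_two, (isNearIdentity_normalExp u).eps]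

theorem toMap_normalHom (u : ℕ → ℕ → ℝ) : toMap (normalHom u) = -timeOne (normalHam u) := by
  funext i
  have hneg : ∀ f, refl f = -f → normalHom u f = -lieExp (normalHam u) f := fun f hf => by
    rw [normalHom, AlgHom.comp_apply, hf, map_neg, lieExpHom_apply]
  fin_cases i
  · exact hneg _ refl_X_zero
  · exact hneg _ refl_X_one

theorem constantCoeff_normalHom_X (u : ℕ → ℕ → ℝ) (i : Fin 3) :
    constantCoeff (normalHom u (X i)) = 0 := by
  rw [normalHom, AlgHom.comp_apply,
    constantCoeff_algHom (isNearIdentity_normalExp u).constantCoeff_X, constantCoeff_refl_X]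

theorem fixesOrigin_neg_timeOne (u : ℕ → ℕ → ℝ) : FixesOrigin (-timeOne (normalHam u)) :=
  toMap_normalHom u ▸ fixesOrigin_toMap (constantCoeff_normalHom_X u)

theorem pull_neg_timeOne (u : ℕ → ℕ → ℝ) :
    pull (-timeOne (normalHam u)) (fixesOrigin_neg_timeOne u) = normalHom u := by
  have h := pull_toMap (normalHom_X_two u) (fixesOrigin_toMap (constantCoeff_normalHom_X u))
  simp only [toMap_normalHom] at h
  exact h

end NormalForm

section Integrals

open Finset.HasAntidiagonal (antidiagonal mem_antidiagonal)

variable {u : ℕ → ℕ → ℝ} {g : Series} {q s : ℕ}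

/-- The algebra of the formal first integrals of the Hamiltonian `χ`. -/
def integrals (χ : Series) : Subalgebra ℝ Series where
  carrier := {f | lieDeriv χ f = 0}
  mul_mem' {f g} (hf : _ = 0) (hg : _ = 0) := show _ = 0 by
    rw [lieDeriv_mul, hf, hg, zero_mul, mul_zero, add_zero]
  add_mem' {f g} (hf : _ = 0) (hg : _ = 0) := show lieOp χ (f + g) = 0 by
    rw [map_add, lieOp_apply, lieOp_apply, hf, hg, add_zero]
  algebraMap_mem' := lieDeriv_C χ

theorem self_mem_integrals (χ : Series) : χ ∈ integrals χ := lieDeriv_self χ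

theorem X_two_mem_integrals (χ : Series) : X 2 ∈ integrals χ := lieDeriv_X_two χ

theorem coeff_sq_pow_mul_pow (a b : ℕ) (n : Fin 3 →₀ ℕ) :
    coeff n ((X 1 ^ 2) ^ a * X 2 ^ b : Series) =
      if Finsupp.single 1 (2 * a) + Finsupp.single 2 b = n then 1 else 0 := by
  classical
  rw [← pow_mul, X_pow_eq, X_pow_eq, monomial_mul_monomial, coeff_monomial, one_mul]
  exact if_congr eq_comm rfl rfl

theorem sub_sum_mem_fil (hg : g ∈ 𝓕 (6 * s))
    (hlead : ∀ n, weight n < 6 * s + 1 → n 0 ≠ 0 ∨ Odd (n 1) → coeff n g = 0) :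
    g - ∑ p ∈ antidiagonal s, coeff (Finsupp.single 1 (2 * p.1) + Finsupp.single 2 p.2) g •
      ((X 1 ^ 2) ^ p.1 * X 2 ^ p.2) ∈ 𝓕 (6 * s + 1) := by
  refine mem_fil.mpr fun n hn => ?_
  have hterm : ∀ p : ℕ × ℕ, coeff n (coeff (Finsupp.single 1 (2 * p.1) + Finsupp.single 2 p.2) g •
      ((X 1 ^ 2) ^ p.1 * X 2 ^ p.2)) =
        if Finsupp.single 1 (2 * p.1) + Finsupp.single 2 p.2 = n then coeff n g else 0 := by
    intro p
    rw [map_smul, coeff_sq_pow_mul_pow, smul_eq_mul, mul_ite, mul_one, mul_zero]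
    exact if_ctx_congr Iff.rfl (fun h => by rw [h]) fun _ => rfl
  rw [map_sub, map_sum, sub_eq_zero, Finset.sum_congr rfl fun p _ => hterm p]
  by_cases hn' : n 0 = 0 ∧ Even (n 1) ∧ weight n = 6 * s
  · obtain ⟨h0, ⟨a, ha⟩, hw⟩ := hn'
    have hn_eq : Finsupp.single 1 (2 * a) + Finsupp.single 2 (n 2) = n := by
      ext i; fin_cases i <;> simp [h0]; omega
    rw [weight] at hw
    rw [Finset.sum_eq_single (a, n 2), if_pos hn_eq]
    · rintro ⟨b, c⟩ - hne
      refine if_neg fun h => hne ?_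
      have h1 : 2 * b = n 1 := by simpa using DFunLike.congr_fun h 1
      have h2 : c = n 2 := by simpa using DFunLike.congr_fun h 2
      rw [h2, show b = a by omega]
    · exact fun h => absurd (mem_antidiagonal.mpr (by simp; omega)) h
  · have hgn : coeff n g = 0 := by
      rcases Nat.lt_succ_iff_lt_or_eq.mp hn with hlt | heq
      · exact mem_fil.mp hg n hlt
      · refine hlead n hn ?_
        rw [← Nat.not_even_iff_odd]
        tauto
    simp only [hgn, ite_self, Finset.sum_const_zero]

/-- If the leading part of `g` depends on `y²` and `ε` only, then replacing `y²` by twice the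
Hamiltonian turns this leading part into a first integral. -/
theorem exists_integral (hu : ∀ m, u 0 m = 0) (hg : g ∈ 𝓕 q)
    (hlead : ∀ n, weight n < q + 1 → n 0 ≠ 0 ∨ Odd (n 1) → coeff n g = 0) :
    ∃ f ∈ integrals (normalHam u), g - f ∈ 𝓕 (q + 1) ∧ refl f = f := by
  by_cases hq : 6 ∣ q
  · obtain ⟨s, rfl⟩ := hq
    set c : ℕ × ℕ → ℝ := fun p => coeff (Finsupp.single 1 (2 * p.1) + Finsupp.single 2 p.2) g
    have hy : (X 1 : Series) ^ 2 ∈ 𝓕 6 := pow_mem_weightIdeal (X_mem_weightIdeal 1) 2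
    have hE : (2 : ℝ) • normalHam u ∈ 𝓕 6 := Submodule.smul_of_tower_mem _ _ (normalHam_mem_fil u)
    have hyE : X 1 ^ 2 - (2 : ℝ) • normalHam u ∈ 𝓕 7 := by
      rw [normalHam_eq, smul_add, two_smul_kinetic, sub_add_cancel_left]
      exact neg_mem (Submodule.smul_of_tower_mem _ _ (fil_mono (potential_mem_fil hu) (by omega)))
    refine ⟨∑ p ∈ antidiagonal s, c p • (((2 : ℝ) • normalHam u) ^ p.1 * X 2 ^ p.2), ?_, ?_, ?_⟩
    · exact sum_mem fun p _ => Subalgebra.smul_mem _ (mul_mem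
        (pow_mem (Subalgebra.smul_mem _ (self_mem_integrals _) _) _)
        (pow_mem (X_two_mem_integrals _) _)) _
    · rw [← sub_add_sub_cancel _ (∑ p ∈ antidiagonal s, c p • ((X 1 ^ 2) ^ p.1 * X 2 ^ p.2))]
      refine add_mem (sub_sum_mem_fil hg hlead) ?_
      rw [← Finset.sum_sub_distrib]
      refine sum_mem fun p hp => ?_
      rw [← smul_sub, ← sub_mul]
      have hp' : p.1 + p.2 = s := mem_antidiagonal.mp hp
      exact Submodule.smul_of_tower_mem _ _ (fil_mono (mul_mem_weightIdeal
        (pow_sub_pow_mem_weightIdeal hy hE hyE p.1)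
        (pow_mem_weightIdeal (X_mem_weightIdeal 2) p.2)) (by simp [varWeight]; omega))
    · simp only [map_sum, map_smul, map_mul, map_pow, refl_X_two, refl_normalHam]
  · refine ⟨0, zero_mem _, ?_, map_zero _⟩
    rw [sub_zero]
    refine mem_fil.mpr fun n hn => ?_
    rcases Nat.lt_succ_iff_lt_or_eq.mp hn with hlt | heq
    · exact mem_fil.mp hg n hlt
    · refine hlead n hn ?_
      by_contra! h
      obtain ⟨h0, h1⟩ := h
      obtain ⟨a, ha⟩ := Nat.not_odd_iff_even.mp h1
      rw [weight] at heq
      exact hq ⟨a + n 2, by omega⟩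

end Integrals

/-! ### Uniqueness for the reflected flows -/

section Uniqueness

variable {u v : ℕ → ℕ → ℝ} {e : ℕ} {A : Series →ₐ[ℝ] Series} {g : Series}

/-- The operator form of a conjugacy `A` between the maps in normal form with coefficients `u`
and `v`, where `A` is the identity up to terms raising the weight by `e`. -/
structure IsNormalConjugacy (u v : ℕ → ℕ → ℝ) (e : ℕ) (A : Series →ₐ[ℝ] Series) : Prop where
  near : IsNearIdentity A
  sub_one_mem_raising : A.toLinearMap - 1 ∈ 𝓡 e
  semiconj : A.toLinearMap * normalExp u = normalExp v * conj A.toLinearMap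

theorem lieOp_lieDeriv_mem_raising {f : Series} {p q r : ℕ} (hf : lieOp f ∈ 𝓡 p)
    (hg : lieOp g ∈ 𝓡 q) (h : r ≤ p + q) : lieOp (lieDeriv f g) ∈ 𝓡 r := by
  rw [← lieOp_commutator]
  exact sub_mem (raising_mono (mul_mem_raising hf hg) h)
    (raising_mono (mul_mem_raising hg hf) (by omega))

theorem lieOp_kinetic_mem_raising : lieOp kinetic ∈ 𝓡 1 := lieOp_mem_raising kinetic_mem_fil

theorem conj_sub_one_mem_raising {T : Module.End ℝ Series} (hT : T - 1 ∈ 𝓡 e) :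
    conj T - 1 ∈ 𝓡 e := by
  rw [← map_one conj, ← map_sub]
  exact conj_mem_raising hT

namespace IsNormalConjugacy

theorem sub_conj_eq (hA : IsNormalConjugacy u v e A) :
    A.toLinearMap - conj A.toLinearMap = normalExp v - normalExp u
      - ((A.toLinearMap - 1) * (normalExp u - 1)
        - (normalExp v - 1) * (conj A.toLinearMap - 1)) := by
  have h := sub_eq_zero.mpr hA.semiconj
  rw [← sub_eq_zero, ← h]
  simp only [mul_sub, sub_mul, mul_one, one_mul]
  abel

theorem sub_conj_mem_raising (hA : IsNormalConjugacy u v e A)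
    (huv : potential v - potential u ∈ 𝓕 (e + 6)) :
    A.toLinearMap - conj A.toLinearMap ∈ 𝓡 (e + 1) := by
  rw [hA.sub_conj_eq]
  refine sub_mem (normalExp_sub_mem_raising huv) (sub_mem ?_ ?_)
  · exact mul_mem_raising hA.sub_one_mem_raising (normalExp_sub_one_mem_raising u)
  · rw [add_comm e]
    exact mul_mem_raising (normalExp_sub_one_mem_raising v)
      (conj_sub_one_mem_raising hA.sub_one_mem_raising)

theorem conj_sub_one_sub_lieOp_mem_raising (hA : IsNormalConjugacy u v e A)
    (huv : potential v - potential u ∈ 𝓕 (e + 6))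
    (hgA : A.toLinearMap - 1 - lieOp g ∈ 𝓡 (e + 1)) :
    conj A.toLinearMap - 1 - lieOp g ∈ 𝓡 (e + 1) := by
  convert sub_mem hgA (hA.sub_conj_mem_raising huv) using 1
  abel

theorem lieOp_refl_sub_mem_raising (hA : IsNormalConjugacy u v e A)
    (huv : potential v - potential u ∈ 𝓕 (e + 6))
    (hgA : A.toLinearMap - 1 - lieOp g ∈ 𝓡 (e + 1)) : lieOp (refl g - g) ∈ 𝓡 (e + 1) := by
  have h := conj_mem_raising hgA
  rw [map_sub, map_sub, map_one, conj_lieOp] at h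
  convert sub_mem (hA.conj_sub_one_sub_lieOp_mem_raising huv hgA) h using 1
  rw [map_sub]
  abel

theorem sub_conj_add_lieOp_mem_raising (hA : IsNormalConjugacy u v e A)
    (hu : ∀ m, u 0 m = 0) (hv : ∀ m, v 0 m = 0)
    (huv : potential v - potential u ∈ 𝓕 (e + 6)) (hg : g ∈ 𝓕 (e + 5))
    (hgA : A.toLinearMap - 1 - lieOp g ∈ 𝓡 (e + 1)) :
    A.toLinearMap - conj A.toLinearMap + lieOp (lieDeriv g kinetic - (potential v - potential u))
      ∈ 𝓡 (e + 2) := by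
  have hleft : (A.toLinearMap - 1) * (normalExp u - 1) - lieOp g * lieOp kinetic ∈ 𝓡 (e + 2) :=
    mul_sub_mul_mem_raising hgA (lieOp_mem_raising hg) (normalExp_sub_one_mem_raising u)
      (normalExp_sub_one_sub_lieOp_kinetic_mem_raising hu)
  have hright : (normalExp v - 1) * (conj A.toLinearMap - 1) - lieOp kinetic * lieOp g ∈
      𝓡 (1 + e + 1) :=
    mul_sub_mul_mem_raising (normalExp_sub_one_sub_lieOp_kinetic_mem_raising hv)
      lieOp_kinetic_mem_raising (conj_sub_one_mem_raising hA.sub_one_mem_raising)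
      (hA.conj_sub_one_sub_lieOp_mem_raising huv hgA)
  convert sub_mem (normalExp_sub_sub_lieOp_mem_raising (d := e + 1) huv)
    (sub_mem hleft (raising_mono hright (by omega))) using 1
  rw [hA.sub_conj_eq, map_sub, ← lieOp_commutator]
  abel

/-- Symmetrization under the reflection: `A - conj A` is odd, while the rest of the relation
`sub_conj_add_lieOp_mem_raising` is even up to terms of higher order. -/
theorem lieOp_lieDeriv_kinetic_sub_mem_raising (hA : IsNormalConjugacy u v e A)
    (hu : ∀ m, u 0 m = 0) (hv : ∀ m, v 0 m = 0)
    (huv : potential v - potential u ∈ 𝓕 (e + 6)) (hg : g ∈ 𝓕 (e + 5))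
    (hgA : A.toLinearMap - 1 - lieOp g ∈ 𝓡 (e + 1)) :
    lieOp (lieDeriv g kinetic - (potential v - potential u)) ∈ 𝓡 (e + 2) := by
  have h := hA.sub_conj_add_lieOp_mem_raising hu hv huv hg hgA
  have hconj := conj_mem_raising h
  have hrefl : lieOp (lieDeriv (refl g - g) kinetic) ∈ 𝓡 (e + 2) :=
    lieOp_lieDeriv_mem_raising (hA.lieOp_refl_sub_mem_raising huv hgA)
      lieOp_kinetic_mem_raising le_rfl
  have hsub : lieDeriv (refl g - g) kinetic = lieDeriv (refl g) kinetic - lieDeriv g kinetic := by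
    rw [← lieOp_apply, map_sub]; rfl
  rw [map_add, map_sub, conj_conj, conj_lieOp, map_sub refl, ← refl_poisson, refl_kinetic,
    map_sub refl, refl_potential, refl_potential] at hconj
  convert Submodule.smul_mem _ (1 / 2 : ℝ) (sub_mem (add_mem h hconj) hrefl) using 1
  rw [hsub]
  simp only [map_sub]
  module

theorem potential_sub_mem_fil_and_dx_mem_fil (hA : IsNormalConjugacy u v e A)
    (hu : ∀ m, u 0 m = 0) (hv : ∀ m, v 0 m = 0)
    (huv : potential v - potential u ∈ 𝓕 (e + 6)) (hg : g ∈ 𝓕 (e + 5))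
    (hgA : A.toLinearMap - 1 - lieOp g ∈ 𝓡 (e + 1)) :
    potential v - potential u ∈ 𝓕 (e + 7) ∧ dx g ∈ 𝓕 (e + 4) := by
  have hrel := lieOp_mem_raising_iff.mp
    (hA.lieOp_lieDeriv_kinetic_sub_mem_raising hu hv huv hg hgA)
  have hw : ∀ n : Fin 3 →₀ ℕ, n 0 = 0 ∨ n 1 ≠ 0 → coeff n (potential v - potential u) = 0 :=
    fun n h => by rw [map_sub, coeff_potential_eq_zero hv h, coeff_potential_eq_zero hu h, sub_zero]
  simp only [lieDeriv_kinetic, map_sub (coeff _), map_neg, coeff_X_mul_eq_ite] at hrel hw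
  constructor <;> refine mem_fil.mpr fun n hn => ?_
  · by_cases h : n 0 = 0 ∨ n 1 ≠ 0
    · rw [map_sub, hw n h]
    · push Not at h
      have hrel := hrel n (by omega) (Or.inl h.1)
      rwa [if_pos h.2, neg_zero, zero_sub, neg_eq_zero, ← map_sub] at hrel
  · have h1 : (n + Finsupp.single 1 1 : Fin 3 →₀ ℕ) 1 ≠ 0 := by simp
    have h := hrel (n + Finsupp.single 1 1) (by simp [weight_add, varWeight]; omega) (Or.inr h1)
    rwa [hw _ (Or.inr h1), sub_zero, if_neg h1, add_tsub_cancel_right, neg_eq_zero] at h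

theorem coeff_hamiltonian_eq_zero (hA : IsNormalConjugacy u v e A)
    (huv : potential v - potential u ∈ 𝓕 (e + 6))
    (hgA : A.toLinearMap - 1 - lieOp g ∈ 𝓡 (e + 1)) (hdx : dx g ∈ 𝓕 (e + 4))
    {n : Fin 3 →₀ ℕ} (hn : weight n < e + 6) (h : n 0 ≠ 0 ∨ Odd (n 1)) : coeff n g = 0 := by
  by_cases h0 : n 0 = 0
  · have hodd : Odd (n 1) := h.resolve_left (not_not_intro h0)
    have hrefl := lieOp_mem_raising_iff.mp (hA.lieOp_refl_sub_mem_raising huv hgA) n (by omega)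
      (Or.inr hodd.pos.ne')
    rw [map_sub, coeff_refl, h0, zero_add, hodd.neg_one_pow] at hrefl
    linarith
  · exact coeff_eq_zero_of_pderiv_mem_weightIdeal hdx h0
      (by rw [weight_varWeight]; exact hn)

theorem comp_lieExpHom {f : Series} (hA : IsNormalConjugacy u v e A) (he : 1 ≤ e)
    (hgA : A.toLinearMap - 1 - lieOp g ∈ 𝓡 (e + 1)) (hf : f ∈ 𝓕 (e + 5)) (hf6 : f ∈ 𝓕 6)
    (hgf : g + f ∈ 𝓕 (e + 6)) (hint : f ∈ integrals (normalHam u)) (hrefl : refl f = f) :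
    IsNormalConjugacy u v (e + 1) (A.comp (lieExpHom f hf6)) where
  near := hA.near.comp (.lieExpHom hf6)
  sub_one_mem_raising := by
    have hsplit : (A.comp (lieExpHom f hf6)).toLinearMap - 1 =
        (A.toLinearMap - 1) * (expOp f hf6 - 1) + (expOp f hf6 - 1 - lieOp f)
          + (A.toLinearMap - 1 - lieOp g) + lieOp (g + f) := by
      change A.toLinearMap * expOp f hf6 - 1 = _
      rw [map_add]
      simp only [mul_sub, sub_mul, mul_one, one_mul]
      abel
    rw [hsplit]
    exact add_mem (add_mem (add_mem
      (raising_mono (mul_mem_raising hA.sub_one_mem_raising (expOp_sub_one_mem_raising hf6 hf))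
        (by omega))
      (raising_mono (expOp_sub_one_sub_lieOp_mem_raising hf6 hf) (by omega))) hgA)
      (lieOp_mem_raising hgf)
  semiconj := by
    have hconj : conj (expOp f hf6) = expOp f hf6 := by
      have := conj_expOp hf6 (hrefl.symm ▸ hf6)
      simp only [hrefl] at this
      exact this
    have hfix : lieExpHom _ (normalHam_mem_fil u) f = f :=
      lieExp_eq_of_lieDeriv_eq_zero (normalHam_mem_fil u) hint
    have hcomm : normalExp u * expOp f hf6 = expOp f hf6 * normalExp u := by
      have := algHom_mul_expOp (normalExp_mem_raising_zero u)
        (isNearIdentity_normalExp u).poisson hf6 (hfix.symm ▸ hf6)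
      simp only [hfix] at this
      exact this
    change A.toLinearMap * expOp f hf6 * normalExp u =
      normalExp v * conj (A.toLinearMap * expOp f hf6)
    rw [map_mul, hconj, mul_assoc, ← hcomm, ← mul_assoc, hA.semiconj, mul_assoc]

theorem exists_succ (hu : ∀ m, u 0 m = 0) (hv : ∀ m, v 0 m = 0) (he : 1 ≤ e)
    (hA : IsNormalConjugacy u v e A) (huv : potential v - potential u ∈ 𝓕 (e + 6)) :
    potential v - potential u ∈ 𝓕 (e + 7) ∧ ∃ B, IsNormalConjugacy u v (e + 1) B := by
  obtain ⟨g, hg, hgA⟩ := hA.near.exists_hamiltonian .id hA.sub_one_mem_raising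
  obtain ⟨huv', hdx⟩ := hA.potential_sub_mem_fil_and_dx_mem_fil hu hv huv hg hgA
  obtain ⟨f, hint, hgf, hrefl⟩ := exists_integral hu hg
    fun n hn h => hA.coeff_hamiltonian_eq_zero huv hgA hdx hn h
  have hf : -f ∈ 𝓕 (e + 5) := by
    simpa using sub_mem (fil_mono hgf (Nat.le_succ _)) hg
  exact ⟨huv', _, hA.comp_lieExpHom he hgA hf (fil_mono hf (by omega))
    (sub_eq_add_neg g f ▸ hgf) (neg_mem hint) (by rw [map_neg, hrefl])⟩

theorem potential_eq (hu : ∀ m, u 0 m = 0) (hv : ∀ m, v 0 m = 0)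
    (hA : IsNormalConjugacy u v 1 A) : potential v = potential u := by
  have key : ∀ e, potential v - potential u ∈ 𝓕 (e + 1 + 6) ∧
      ∃ B, IsNormalConjugacy u v (e + 1) B := by
    intro e
    induction e with
    | zero =>
      exact ⟨fil_mono (sub_mem (potential_mem_fil hv) (potential_mem_fil hu)) (by omega), A, hA⟩
    | succ e ih =>
      obtain ⟨huv, B, hB⟩ := ih
      exact hB.exists_succ hu hv (by omega) huv
  exact eq_of_forall_sub_mem_fil fun N => fil_mono (key N).1 (by omega)

end IsNormalConjugacy

end Uniqueness

/-! ### Existence for automorphisms close to the identity -/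

section HomologicalEquation

variable {g : Series} {d : ℕ}

/-- The quotient of `f`, without its terms free of the variable `X i`, by `X i`. -/
def divX {σ R : Type*} [CommSemiring R] (i : σ) (f : MvPowerSeries σ R) : MvPowerSeries σ R :=
  fun n => coeff (n + Finsupp.single i 1) f

theorem coeff_divX {σ R : Type*} [CommSemiring R] (i : σ) (f : MvPowerSeries σ R) (n : σ →₀ ℕ) :
    coeff n (divX i f) = coeff (n + Finsupp.single i 1) f :=
  rfl

theorem coeff_X_mul_divX {σ R : Type*} [CommRing R] (i : σ) (f : MvPowerSeries σ R) (n : σ →₀ ℕ) :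
    coeff n (X i * divX i f) = if n i = 0 then 0 else coeff n f := by
  rw [coeff_X_mul_eq_ite]
  refine ite_congr rfl (fun _ => rfl) fun h => ?_
  rw [coeff_divX,
    tsub_add_cancel_of_le (Finsupp.single_le_iff.mpr (Nat.one_le_iff_ne_zero.mpr h))]

/-- The solution `δ` of the homological equation: `{y² / 2, δ}` cancels the terms of `g` that are
divisible by `y`. -/
def homologicalSolution (g : Series) : Series := -primitive 0 (divX 1 g)

theorem lieDeriv_homologicalSolution_kinetic (g : Series) :
    lieDeriv (homologicalSolution g) kinetic = X 1 * divX 1 g := by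
  rw [lieDeriv_kinetic, homologicalSolution, dx_neg, mul_neg, neg_neg, dx, pderiv_primitive]

theorem homologicalSolution_mem_fil (hg : g ∈ 𝓕 (d + 6)) : homologicalSolution g ∈ 𝓕 (d + 5) := by
  have hdiv : divX 1 g ∈ 𝓕 (d + 3) := mem_fil.mpr fun n hn =>
    mem_fil.mp hg _ (by simp [weight_add, varWeight]; omega)
  exact neg_mem (primitive_mem_weightIdeal hdiv 0)

theorem refl_homologicalSolution (hg : refl g = g) :
    refl (homologicalSolution g) = homologicalSolution g := by
  ext n
  rw [coeff_refl, homologicalSolution, map_neg, coeff_primitive, coeff_divX]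
  rcases Nat.eq_zero_or_pos (n 0) with h0 | h0
  · simp [h0]
  · have hparity : (n - Finsupp.single 0 1 + Finsupp.single 1 1 : Fin 3 →₀ ℕ) 0 +
        (n - Finsupp.single 0 1 + Finsupp.single 1 1 : Fin 3 →₀ ℕ) 1 = n 0 + n 1 := by
      simp; omega
    have h := congrArg (coeff (n - Finsupp.single 0 1 + Finsupp.single 1 1)) hg
    rw [coeff_refl, hparity] at h
    rw [mul_neg, ← mul_div_assoc, h]

/-- The coefficients of the terms of `g` that depend on `x` alone up to powers of `ε`; they remain
in the normal form. -/
def normalCoeff (g : Series) (k m : ℕ) : ℝ :=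
  if k = 0 then 0 else coeff (Finsupp.single 0 (2 * k) + Finsupp.single 2 m) g

@[simp] theorem normalCoeff_zero (g : Series) (m : ℕ) : normalCoeff g 0 m = 0 := if_pos rfl

theorem normalCoeff_eq_zero (hg : g ∈ 𝓕 d) {k m : ℕ} (h : 4 * k + 6 * m < d) :
    normalCoeff g k m = 0 :=
  ite_eq_left_iff.mpr fun _ => mem_fil.mp hg _ (by
    simp only [weight_add, weight_single, varWeight, Matrix.cons_val]
    omega)

theorem potential_normalCoeff_mem_fil (hg : g ∈ 𝓕 d) : potential (normalCoeff g) ∈ 𝓕 d :=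
  mem_fil.mpr fun n hn => by
    rw [coeff_potential]
    refine ite_eq_right_iff.mpr fun h => normalCoeff_eq_zero hg ?_
    have := Nat.two_mul_div_two_of_even h.1
    unfold weight at hn
    omega

theorem coeff_potential_normalCoeff (hg : g ∈ 𝓕 7) (hrefl : refl g = g) {n : Fin 3 →₀ ℕ}
    (h0 : n 0 ≠ 0) (h1 : n 1 = 0) : coeff n (potential (normalCoeff g)) = coeff n g := by
  rw [coeff_potential]
  by_cases heven : Even (n 0)
  · have h2 := Nat.two_mul_div_two_of_even heven
    have hn : Finsupp.single 0 (2 * (n 0 / 2)) + Finsupp.single 2 (n 2) = n := by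
      ext i
      fin_cases i <;> simp [h1, h2]
    split_ifs with h
    · rw [normalCoeff, if_neg (by omega), hn]
    · refine (mem_fil.mp hg n ?_).symm
      have : ¬ 2 ≤ n 0 / 2 + 2 * n 2 := fun h' => h ⟨heven, h1, h'⟩
      unfold weight
      omega
  · have hodd := congrArg (coeff n) hrefl
    rw [coeff_refl, h1, add_zero, (Nat.not_even_iff_odd.mp heven).neg_one_pow] at hodd
    rw [if_neg (fun h => heven h.1)]
    linarith

theorem lieOp_sub_homological_mem_raising (hg : g ∈ 𝓕 7) (hrefl : refl g = g) :
    lieOp (g - lieDeriv (homologicalSolution g) kinetic - potential (normalCoeff g)) ∈ 𝓡 d := by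
  refine lieOp_mem_raising_iff.mpr fun n _ h => ?_
  rw [lieDeriv_homologicalSolution_kinetic, map_sub, map_sub, coeff_X_mul_divX]
  split_ifs with h1
  · rw [coeff_potential_normalCoeff hg hrefl (h.resolve_right (not_not_intro h1)) h1, sub_zero,
      sub_self]
  · rw [coeff_potential_eq_zero (normalCoeff_zero g) (Or.inr h1), sub_zero, sub_self]

end HomologicalEquation

section Existence

variable {A B : Series →ₐ[ℝ] Series} {u v : ℕ → ℕ → ℝ} {f g χ : Series} {d : ℕ}

/-- The error in the conjugacy equation `B ∘ conj A = A ∘ exp(L_h)` for the homomorphism `B`,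
the approximate conjugacy `A` and the Hamiltonian `h` in normal form with coefficients `u`. -/
def defect (B A : Series →ₐ[ℝ] Series) (u : ℕ → ℕ → ℝ) : Module.End ℝ Series :=
  B.toLinearMap * conj A.toLinearMap - A.toLinearMap * normalExp u

theorem defect_comp_lieExpHom_sub_mem_raising (hA : IsNearIdentity A) (hχ : χ ∈ 𝓕 6)
    (hf : f ∈ 𝓕 (d + 5)) (hg : g ∈ 𝓕 (d + 5)) (h : defect B A u - lieOp f ∈ 𝓡 (d + 1))
    (hcomm : normalExp u * conj (expOp χ hχ) - expOp χ hχ * normalExp u - lieOp g ∈ 𝓡 (d + 1)) :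
    defect B (A.comp (lieExpHom χ hχ)) u - lieOp (f + g) ∈ 𝓡 (d + 1) := by
  have hexp : conj (expOp χ hχ) - 1 ∈ 𝓡 (0 + 1) :=
    conj_sub_one_mem_raising (expOp_sub_one_mem_raising hχ hχ)
  have hexp0 : conj (expOp χ hχ) ∈ 𝓡 0 :=
    conj_mem_raising (IsNearIdentity.lieExpHom hχ).mem_raising_zero
  have hleft := mul_sub_mul_mem_raising h (lieOp_mem_raising hf) hexp0 hexp
  have hright := mul_sub_mul_mem_raising (d := 0) hA.sub_one_mem_raising one_mem_raising_zero
    (by simpa using add_mem (raising_mono hcomm d.le_succ) (lieOp_mem_raising hg)) hcomm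
  convert add_mem hleft (raising_mono hright (by omega)) using 1
  change B.toLinearMap * conj (A.toLinearMap * expOp χ hχ) -
    A.toLinearMap * expOp χ hχ * normalExp u - lieOp (f + g) = _
  rw [defect, map_mul, map_add, mul_sub, sub_mul, mul_one, one_mul]
  simp only [mul_assoc]
  abel

theorem defect_comp_lieExpHom_of_odd (hA : IsNearIdentity A) (hd : 1 ≤ d) (hf : f ∈ 𝓕 (d + 5))
    (h : defect B A u - lieOp f ∈ 𝓡 (d + 1)) (hχ : χ ∈ 𝓕 6) (hχd : χ ∈ 𝓕 (d + 5))
    (hodd : refl χ = -χ) :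
    defect B (A.comp (lieExpHom χ hχ)) u - lieOp (f + (-2 : ℝ) • χ) ∈ 𝓡 (d + 1) := by
  refine defect_comp_lieExpHom_sub_mem_raising hA hχ hf (Submodule.smul_of_tower_mem _ _ hχd) h ?_
  have hexp := expOp_sub_one_mem_raising hχ hχd
  have hlin := raising_mono (expOp_sub_one_sub_lieOp_mem_raising hχ hχd)
    (show d + 1 ≤ 2 * d by omega)
  have hlin' := conj_mem_raising hlin
  rw [map_sub, map_sub, map_one, conj_lieOp, hodd, map_neg] at hlin'
  have hcomm := sub_mem
    (mul_mem_raising (normalExp_sub_one_mem_raising u) (conj_sub_one_mem_raising hexp))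
    (raising_mono (mul_mem_raising hexp (normalExp_sub_one_mem_raising u)) (by omega))
  convert add_mem (raising_mono hcomm (by omega)) (sub_mem hlin' hlin) using 1
  rw [map_smul]
  simp only [mul_sub, sub_mul, mul_one, one_mul]
  module

theorem defect_comp_lieExpHom_of_even (hA : IsNearIdentity A) (hu : ∀ m, u 0 m = 0)
    (hf : f ∈ 𝓕 (d + 6)) (h : defect B A u - lieOp f ∈ 𝓡 (d + 2)) (hd : 1 ≤ d) (hχ : χ ∈ 𝓕 6)
    (hχd : χ ∈ 𝓕 (d + 5)) (heven : refl χ = χ) :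
    defect B (A.comp (lieExpHom χ hχ)) u - lieOp (f - lieDeriv χ kinetic) ∈ 𝓡 (d + 2) := by
  have hbracket : -lieDeriv χ kinetic ∈ 𝓕 (d + 1 + 5) :=
    neg_mem (lieDeriv_mem_fil hχd kinetic_mem_fil (by omega))
  rw [sub_eq_add_neg f]
  refine defect_comp_lieExpHom_sub_mem_raising (d := d + 1) hA hχ hf hbracket h ?_
  have hconj : conj (expOp χ hχ) = expOp χ hχ := by
    have := conj_expOp hχ (heven.symm ▸ hχ)
    simp only [heven] at this
    exact this
  have hexp := expOp_sub_one_mem_raising hχ hχd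
  have hlin := raising_mono (expOp_sub_one_sub_lieOp_mem_raising hχ hχd)
    (show d + 1 ≤ 2 * d by omega)
  have hkin := normalExp_sub_one_sub_lieOp_kinetic_mem_raising hu
  have hleft := mul_sub_mul_mem_raising hkin lieOp_kinetic_mem_raising hexp hlin
  have hright := mul_sub_mul_mem_raising hlin (lieOp_mem_raising hχd)
    (normalExp_sub_one_mem_raising u) hkin
  convert sub_mem (raising_mono hleft (show d + 2 ≤ 1 + d + 1 by omega)) hright using 1
  rw [hconj, map_neg, ← lieOp_commutator]
  simp only [mul_sub, sub_mul, mul_one, one_mul]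
  abel

theorem defect_sub_lieOp_potential_mem_raising (hA : IsNearIdentity A)
    (huv : potential v - potential u ∈ 𝓕 (d + 5)) (h : defect B A u - lieOp f ∈ 𝓡 (d + 1)) :
    defect B A v - lieOp (f - (potential v - potential u)) ∈ 𝓡 (d + 1) := by
  have hA1 := mul_mem_raising hA.sub_one_mem_raising (normalExp_sub_mem_raising huv)
  convert sub_mem h (add_mem (raising_mono hA1 (show d + 1 ≤ 1 + d by omega))
    (normalExp_sub_sub_lieOp_mem_raising huv)) using 1
  rw [defect, defect, map_sub lieOp f]
  simp only [mul_sub, sub_mul, one_mul]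
  abel

theorem comp_lieExpHom_sub_mem_raising (hA : IsNearIdentity A) (hχ : χ ∈ 𝓕 6)
    (hχd : χ ∈ 𝓕 (d + 5)) : (A.comp (lieExpHom χ hχ)).toLinearMap - A.toLinearMap ∈ 𝓡 d := by
  have h := mul_mem_raising hA.mem_raising_zero (expOp_sub_one_mem_raising hχ hχd)
  rw [zero_add, mul_sub, mul_one] at h
  exact h

theorem exists_even_defect (hA : IsNearIdentity A) (hd : 1 ≤ d) (hg : g ∈ 𝓕 (d + 5))
    (h : defect B A u - lieOp g ∈ 𝓡 (d + 1)) :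
    ∃ A', IsNearIdentity A' ∧ A'.toLinearMap - A.toLinearMap ∈ 𝓡 d ∧
      defect B A' u - lieOp ((1 / 2 : ℝ) • (g + refl g)) ∈ 𝓡 (d + 1) := by
  have hχ : (1 / 4 : ℝ) • (g - refl g) ∈ 𝓕 (d + 5) :=
    Submodule.smul_of_tower_mem _ _ (sub_mem hg (refl_mem_raising_zero _ _ hg))
  have hχ6 : (1 / 4 : ℝ) • (g - refl g) ∈ 𝓕 6 := fil_mono hχ (by omega)
  have hodd : refl ((1 / 4 : ℝ) • (g - refl g)) = -((1 / 4 : ℝ) • (g - refl g)) := by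
    rw [map_smul, map_sub, refl_refl]
    module
  refine ⟨A.comp (lieExpHom _ hχ6), hA.comp (.lieExpHom hχ6),
    comp_lieExpHom_sub_mem_raising hA hχ6 hχ, ?_⟩
  convert defect_comp_lieExpHom_of_odd hA hd hg h hχ6 hχ hodd using 3
  module

theorem exists_normalCoeff_defect (hA : IsNearIdentity A) (hd : 1 ≤ d) (hu : ∀ m, u 0 m = 0)
    (hg : g ∈ 𝓕 (d + 6)) (heven : refl g = g) (h : defect B A u - lieOp g ∈ 𝓡 (d + 2)) :
    ∃ A', IsNearIdentity A' ∧ A'.toLinearMap - A.toLinearMap ∈ 𝓡 d ∧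
      defect B A' (u + normalCoeff g) ∈ 𝓡 (d + 2) := by
  have hδ : homologicalSolution g ∈ 𝓕 (d + 5) := homologicalSolution_mem_fil hg
  have hδ6 : homologicalSolution g ∈ 𝓕 6 := fil_mono hδ (by omega)
  have hA' : IsNearIdentity (A.comp (lieExpHom _ hδ6)) := hA.comp (.lieExpHom hδ6)
  have hpot : potential (u + normalCoeff g) - potential u = potential (normalCoeff g) := by
    rw [potential_add, add_sub_cancel_left]
  have hδdefect := defect_comp_lieExpHom_of_even hA hu hg h hd hδ6 hδ
    (refl_homologicalSolution heven)
  have hηdefect := defect_sub_lieOp_potential_mem_raising (d := d + 1) hA'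
    (hpot ▸ potential_normalCoeff_mem_fil hg) hδdefect
  rw [hpot] at hηdefect
  refine ⟨_, hA', comp_lieExpHom_sub_mem_raising hA hδ6 hδ, ?_⟩
  simpa using add_mem hηdefect
    (lieOp_sub_homological_mem_raising (d := d + 2) (fil_mono hg (by omega)) heven)

theorem exists_lieOp_sub_mem_raising (hB : IsNearIdentity B) (hA : IsNearIdentity A)
    (h : defect B A u ∈ 𝓡 d) : ∃ g ∈ 𝓕 (d + 5), defect B A u - lieOp g ∈ 𝓡 (d + 1) := by
  have hdefect : defect B A u = (B.comp (refl.comp (A.comp refl))).toLinearMap -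
      (A.comp (lieExpHom _ (normalHam_mem_fil u))).toLinearMap := rfl
  rw [hdefect] at h ⊢
  exact (hB.comp hA.conj).exists_hamiltonian (hA.comp (isNearIdentity_normalExp u)) h

/-- The state of the normalization of `B` after the terms raising the weight by less than `d` have
been put into normal form. -/
structure IsNormalizedTo (B : Series →ₐ[ℝ] Series) (d : ℕ) (A : Series →ₐ[ℝ] Series)
    (u : ℕ → ℕ → ℝ) : Prop where
  near : IsNearIdentity A
  coeff_zero : ∀ m, u 0 m = 0
  defect_mem_raising : defect B A u ∈ 𝓡 d

theorem IsNormalizedTo.exists_succ (hB : IsNearIdentity B) (hd : 1 ≤ d)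
    (hA : IsNormalizedTo B (d + 1) A u) :
    ∃ A' u', IsNormalizedTo B (d + 2) A' u' ∧ A'.toLinearMap - A.toLinearMap ∈ 𝓡 d ∧
      ∀ k m, 4 * k + 6 * m < d + 6 → u' k m = u k m := by
  obtain ⟨g, hg, hgA⟩ := exists_lieOp_sub_mem_raising hB hA.near hA.defect_mem_raising
  obtain ⟨A₁, hA₁, hA₁A, hdefect₁⟩ := exists_even_defect hA.near (by omega) hg hgA
  have hg' : (1 / 2 : ℝ) • (g + refl g) ∈ 𝓕 (d + 6) :=
    Submodule.smul_of_tower_mem _ _ (add_mem hg (refl_mem_raising_zero _ _ hg))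
  obtain ⟨A₂, hA₂, hA₂A₁, hdefect₂⟩ := exists_normalCoeff_defect hA₁ hd hA.coeff_zero hg'
    (by rw [map_smul, map_add, refl_refl, add_comm]) hdefect₁
  refine ⟨A₂, _, ⟨hA₂, fun m => by simp [hA.coeff_zero m], hdefect₂⟩, ?_, fun k m hkm => ?_⟩
  · simpa using add_mem hA₂A₁ (raising_mono hA₁A d.le_succ)
  · rw [Pi.add_apply, Pi.add_apply, normalCoeff_eq_zero hg' hkm, add_zero]

theorem lieOp_half_add_refl_mem_raising_two (hg : g ∈ 𝓕 6)
    (hy : coeff (Finsupp.single 1 2) g = 0) : lieOp ((1 / 2 : ℝ) • (g + refl g)) ∈ 𝓡 2 := by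
  refine lieOp_mem_raising_iff.mpr fun n hn h => ?_
  rw [map_smul, map_add, coeff_refl, smul_eq_mul]
  by_cases hodd : Odd (n 0 + n 1)
  · rw [hodd.neg_one_pow]
    ring
  · suffices coeff n g = 0 by rw [this, mul_zero, add_zero, mul_zero]
    obtain ⟨k, hk⟩ := Nat.not_odd_iff_even.mp hodd
    by_cases hw : weight n < 6
    · exact mem_fil.mp hg n hw
    · unfold weight at hn hw
      have hn1 : n = Finsupp.single 1 2 := by
        ext i
        fin_cases i <;> simp <;> omega
      rw [hn1, hy]

theorem defect_id (B : Series →ₐ[ℝ] Series) (u : ℕ → ℕ → ℝ) :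
    defect B (AlgHom.id ℝ Series) u = B.toLinearMap - normalExp u := by
  change B.toLinearMap * conj 1 - 1 * normalExp u = _
  rw [map_one, mul_one, one_mul]

theorem coeff_y_sq_of_sub_lieOp_mem_raising (h : B.toLinearMap - 1 - lieOp g ∈ 𝓡 2)
    (hlin : coeff (Finsupp.single 1 1) (B (X 0)) = 1) : coeff (Finsupp.single 1 2) g = 1 / 2 := by
  have hx : B (X 0) - X 0 - dy g ∈ 𝓕 4 := by
    have := h _ _ (X_mem_weightIdeal 0)
    rw [LinearMap.sub_apply, lieOp_apply, lieDeriv_X_zero] at this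
    exact this
  have hx0 : coeff (Finsupp.single 1 1) (X 0 : Series) = 0 := by
    classical
    rw [coeff_X, if_neg]
    exact fun h => by simpa using DFunLike.congr_fun h 0
  have hy := mem_fil.mp hx (Finsupp.single 1 1) (by simp [varWeight])
  rw [map_sub, map_sub, hlin, hx0, coeff_dy, ← Finsupp.single_add, Finsupp.single_eq_same] at hy
  norm_num at hy
  linarith

theorem exists_isNormalizedTo_two (hB : IsNearIdentity B)
    (hlin : coeff (Finsupp.single 1 1) (B (X 0)) = 1) : ∃ A, IsNormalizedTo B 2 A 0 := by
  obtain ⟨g, hg, hgB⟩ := hB.exists_hamiltonian .id hB.sub_one_mem_raising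
  have hdefect : defect B (AlgHom.id ℝ Series) 0 - lieOp (g - kinetic) ∈ 𝓡 2 := by
    have hexp := normalExp_sub_one_sub_lieOp_kinetic_mem_raising (u := 0) fun _ => rfl
    convert sub_mem hgB hexp using 1
    rw [defect_id, map_sub, show (AlgHom.id ℝ Series).toLinearMap = 1 from rfl]
    abel
  have hg' : g - kinetic ∈ 𝓕 6 := sub_mem hg kinetic_mem_fil
  have hy : coeff (Finsupp.single 1 2) (g - kinetic) = 0 := by
    rw [map_sub, coeff_y_sq_of_sub_lieOp_mem_raising hgB hlin, coeff_kinetic, if_pos rfl, sub_self]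
  obtain ⟨A, hA, -, hA2⟩ := exists_even_defect .id le_rfl hg' hdefect
  refine ⟨A, hA, fun _ => rfl, ?_⟩
  simpa using add_mem hA2 (lieOp_half_add_refl_mem_raising_two hg' hy)

theorem exists_seq_of_exists_succ {α : Type*} {P : ℕ → α → Prop} {r : ℕ → α → α → Prop}
    (h0 : ∃ a, P 0 a) (hsucc : ∀ n a, P n a → ∃ b, P (n + 1) b ∧ r n a b) :
    ∃ s : ℕ → α, (∀ n, P n (s n)) ∧ ∀ n, r n (s n) (s (n + 1)) := by
  obtain ⟨a, ha⟩ := h0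
  choose! next hnext hr using hsucc
  let s : ℕ → α := fun n => Nat.rec a next n
  have hs : ∀ n, P n (s n) := fun n => Nat.rec ha (fun n ih => hnext n (s n) ih) n
  exact ⟨s, hs, fun n => hr n (s n) (hs n)⟩

theorem exists_seq_isNormalizedTo (hB : IsNearIdentity B)
    (hlin : coeff (Finsupp.single 1 1) (B (X 0)) = 1) :
    ∃ (A : ℕ → Series →ₐ[ℝ] Series) (u : ℕ → ℕ → ℕ → ℝ),
      (∀ d, IsNormalizedTo B (d + 2) (A d) (u d)) ∧
      (∀ d, (A (d + 1)).toLinearMap - (A d).toLinearMap ∈ 𝓡 (d + 1)) ∧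
      ∀ d k m, 4 * k + 6 * m < d + 7 → u (d + 1) k m = u d k m := by
  obtain ⟨A₀, hA₀⟩ := exists_isNormalizedTo_two hB hlin
  obtain ⟨s, hs, hstep⟩ := exists_seq_of_exists_succ
    (P := fun d (p : (Series →ₐ[ℝ] Series) × (ℕ → ℕ → ℝ)) => IsNormalizedTo B (d + 2) p.1 p.2)
    (r := fun d p p' => p'.1.toLinearMap - p.1.toLinearMap ∈ 𝓡 (d + 1) ∧
      ∀ k m, 4 * k + 6 * m < d + 7 → p'.2 k m = p.2 k m) ⟨(A₀, 0), hA₀⟩ fun d p hp => by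
    obtain ⟨A', u', hA', hAA', huu'⟩ := hp.exists_succ hB (Nat.le_add_left 1 d)
    exact ⟨(A', u'), hA', hAA', huu'⟩
  exact ⟨fun d => (s d).1, fun d => (s d).2, hs, fun d => (hstep d).1, fun d => (hstep d).2⟩

theorem exists_limit_coeff {u : ℕ → ℕ → ℕ → ℝ}
    (h : ∀ d k m, 4 * k + 6 * m < d + 7 → u (d + 1) k m = u d k m) :
    ∃ v, ∀ d, potential v - potential (u d) ∈ 𝓕 (d + 5) := by
  have hconst : ∀ k m, ∀ d ≥ 4 * k + 6 * m - 6, u d k m = u (4 * k + 6 * m - 6) k m :=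
    fun k m d hd => Nat.le_induction rfl (fun d hd ih => by rw [h d k m (by omega), ih]) d hd
  refine ⟨fun k m => u (4 * k + 6 * m - 6) k m, fun d => mem_fil.mpr fun n hn => ?_⟩
  rw [map_sub, coeff_potential, coeff_potential, sub_eq_zero]
  refine ite_congr rfl (fun heven => (hconst _ _ d ?_).symm) fun _ => rfl
  have := Nat.two_mul_div_two_of_even heven.1
  unfold weight at hn
  omega

theorem exists_conjugacy (hB : IsNearIdentity B)
    (hlin : coeff (Finsupp.single 1 1) (B (X 0)) = 1) :
    ∃ A u, IsNearIdentity A ∧ B.toLinearMap * conj A.toLinearMap = A.toLinearMap * normalExp u := by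
  obtain ⟨A, u, hA, hAA, huu⟩ := exists_seq_isNormalizedTo hB hlin
  obtain ⟨L, hL, hLA⟩ := IsNearIdentity.exists_limit (fun d => (hA d).near) hAA
  obtain ⟨v, hv⟩ := exists_limit_coeff huu
  refine ⟨L, v, hL, eq_of_forall_sub_mem_raising fun d => ?_⟩
  have hLd := raising_mono (hLA d) d.le_succ
  have hleft := mul_mem_raising hB.mem_raising_zero (conj_mem_raising hLd)
  have hmid := mul_mem_raising hLd (normalExp_mem_raising_zero v)
  have hright := mul_mem_raising (hA d).near.mem_raising_zero (normalExp_sub_mem_raising (hv d))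
  rw [zero_add] at hleft hright
  convert add_mem (sub_mem (sub_mem hleft hmid) hright)
    (raising_mono (hA d).defect_mem_raising (show d ≤ d + 2 by omega)) using 1
  rw [defect, map_sub]
  simp only [mul_sub, sub_mul]
  abel

end Existence

/-! ### Formal families -/

section LinearPart

variable {G H : FormalMap} {f : Series} {M N P : Matrix (Fin 2) (Fin 2) ℝ}

/-- The matrix of the linear part `DG₀(0)`. -/
def jacMatrix (G : FormalMap) : Matrix (Fin 2) (Fin 2) ℝ :=
  !![constantCoeff (dx (G 0)), constantCoeff (dy (G 0));
     constantCoeff (dx (G 1)), constantCoeff (dy (G 1))]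

theorem linearPart_eq_toLin' (G : FormalMap) : linearPart G = Matrix.toLin' (jacMatrix G) := rfl

theorem det_jacMatrix (G : FormalMap) : (jacMatrix G).det = constantCoeff (jacobianDet G) := by
  rw [jacMatrix, Matrix.det_fin_two_of, jacobianDet, map_sub, map_mul, map_mul]

theorem IsAreaPreserving.det_jacMatrix (h : IsAreaPreserving G) :
    (jacMatrix G).det = 1 ∨ (jacMatrix G).det = -1 := by
  rw [AreaPreservingNF.det_jacMatrix]
  rcases h with h | h <;> simp [h]

theorem jacMatrix_neg (G : FormalMap) : jacMatrix (-G) = -jacMatrix G := by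
  simp [jacMatrix]

theorem jacMatrix_comp (hH : FixesOrigin H) : jacMatrix (comp G H) = jacMatrix G * jacMatrix H := by
  have hc := constantCoeff_algHom (constantCoeff_pull_X hH)
  rw [comp_eq_pull hH]
  simp only [jacMatrix, dx_algHom (constantCoeff_pull_X hH) (pull_X_two hH),
    dy_algHom (constantCoeff_pull_X hH) (pull_X_two hH), map_add, map_mul, hc, pull_X_zero,
    pull_X_one]
  rw [Matrix.mul_fin_two]

theorem jacMatrix_congr (h : ∀ i, G i - H i ∈ 𝓕 4) : jacMatrix G = jacMatrix H := by
  have hdx : ∀ i, constantCoeff (dx (G i)) = constantCoeff (dx (H i)) := fun i => by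
    rw [← sub_eq_zero, ← map_sub, ← dx_sub]
    exact mem_fil_one.mp (fil_mono (dx_mem_fil (h i)) (by omega))
  have hdy : ∀ i, constantCoeff (dy (G i)) = constantCoeff (dy (H i)) := fun i => by
    rw [← sub_eq_zero, ← map_sub, ← dy_sub]
    exact mem_fil_one.mp (dy_mem_fil (h i))
  simp only [jacMatrix, hdx, hdy]

theorem mem_fil_three (h : constantCoeff f = 0) (hdx : constantCoeff (dx f) = 0) : f ∈ 𝓕 3 := by
  refine mem_fil.mpr fun n hn => ?_
  unfold weight at hn
  rw [← coeff_zero_eq_constantCoeff_apply] at h hdx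
  rcases Nat.eq_zero_or_pos (n 0) with h0 | h0
  · have hn0 : n = 0 := by ext i; fin_cases i <;> simp <;> omega
    rw [hn0, h]
  · have hn0 : n = 0 + Finsupp.single 0 1 := by ext i; fin_cases i <;> simp <;> omega
    rw [hn0]
    simpa [coeff_dx] using hdx

theorem mem_fil_four (h : constantCoeff f = 0) (hdx : constantCoeff (dx f) = 0)
    (hdy : constantCoeff (dy f) = 0) : f ∈ 𝓕 4 := by
  refine mem_fil.mpr fun n hn => ?_
  by_cases hn3 : weight n < 3
  · exact mem_fil.mp (mem_fil_three h hdx) n hn3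
  · unfold weight at hn hn3
    have hn1 : n = 0 + Finsupp.single 1 1 := by ext i; fin_cases i <;> simp <;> omega
    rw [← coeff_zero_eq_constantCoeff_apply] at hdy
    rw [hn1]
    simpa [coeff_dy] using hdy

theorem isNearIdentity_pull (hG : FixesOrigin G) (harea : IsAreaPreserving G) {b : ℝ}
    (hJ : jacMatrix G = !![1, b; 0, 1]) : IsNearIdentity (pull G hG) := by
  have h00 : constantCoeff (dx (G 0)) = 1 := congrFun₂ hJ 0 0
  have h10 : constantCoeff (dx (G 1)) = 0 := congrFun₂ hJ 1 0
  have h11 : constantCoeff (dy (G 1)) = 1 := congrFun₂ hJ 1 1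
  refine .of_X (pull_X_two hG) (mem_fil_three ?_ ?_) (mem_fil_four ?_ ?_ ?_) ?_
  · simp [hG 0]
  · simp [h00]
  · simp [hG 1]
  · simp [h10]
  · simp [h11]
  · rw [pull_X_zero, pull_X_one, ← jacobianDet_eq_lieDeriv]
    refine harea.resolve_right fun h => ?_
    have hdet := det_jacMatrix G
    rw [hJ, h] at hdet
    norm_num at hdet

theorem FixesOrigin.neg (hG : FixesOrigin G) : FixesOrigin (-G) := fun i => by
  rw [Pi.neg_apply, map_neg, hG i, neg_zero]

theorem IsAreaPreserving.neg (hG : IsAreaPreserving G) : IsAreaPreserving (-G) := by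
  have h : jacobianDet (-G) = jacobianDet G := by simp [jacobianDet]
  rwa [IsAreaPreserving, h]

theorem pull_neg (hG : FixesOrigin G) : pull (-G) hG.neg = (pull G hG).comp refl := by
  refine algHom_ext (constantCoeff_pull_X _) fun i => ?_
  fin_cases i <;> simp

/-- The linear family of maps with matrix `P`. -/
def linMap (P : Matrix (Fin 2) (Fin 2) ℝ) : FormalMap := fun i => P i 0 • X 0 + P i 1 • X 1

theorem fixesOrigin_linMap (P : Matrix (Fin 2) (Fin 2) ℝ) : FixesOrigin (linMap P) := by
  intro i
  simp [linMap]

theorem jacMatrix_linMap (P : Matrix (Fin 2) (Fin 2) ℝ) : jacMatrix (linMap P) = P := by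
  ext i j
  fin_cases i <;> fin_cases j <;> simp [jacMatrix, linMap]

theorem comp_linMap (P Q : Matrix (Fin 2) (Fin 2) ℝ) :
    comp (linMap P) (linMap Q) = linMap (P * Q) := by
  rw [comp_eq_pull (fixesOrigin_linMap Q)]
  funext i
  simp only [linMap, map_add, map_smul, pull_X_zero, pull_X_one, Matrix.mul_apply,
    Fin.sum_univ_two]
  module

theorem linMap_one : linMap 1 = idMap := by
  refine funext (Fin.forall_fin_two.mpr ⟨?_, ?_⟩) <;> simp [linMap, idMap]

theorem jacobianDet_linMap (P : Matrix (Fin 2) (Fin 2) ℝ) : jacobianDet (linMap P) = C P.det := by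
  simp only [jacobianDet, linMap, Matrix.det_fin_two, dx_add, dx_smul, dy_add, dy_smul, dx_X_zero,
    dx_X_one, dy_X_zero, dy_X_one, smul_zero, add_zero, zero_add]
  simp only [smul_eq_C_mul, mul_one, map_sub, map_mul]

theorem isCanonicalChange_linMap (h : P.det = 1 ∨ P.det = -1) :
    IsCanonicalChange (linMap P) (linMap P⁻¹) where
  fixes := fixesOrigin_linMap P
  area := by
    rw [IsAreaPreserving, jacobianDet_linMap]
    rcases h with h | h <;> simp [h]
  fixes_inv := fixesOrigin_linMap _
  left_inv := by
    rw [comp_linMap, Matrix.nonsing_inv_mul _ (by rcases h with h | h <;> simp [h]), linMap_one]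
  right_inv := by
    rw [comp_linMap, Matrix.mul_nonsing_inv _ (by rcases h with h | h <;> simp [h]), linMap_one]

theorem exists_mul_self_mul_eq_one_or_neg_one {c : ℝ} (hc : c ≠ 0) :
    ∃ r : ℝ, r * r * c = 1 ∨ r * r * c = -1 := by
  refine ⟨(√|c|)⁻¹, ?_⟩
  rw [← mul_inv, Real.mul_self_sqrt (abs_nonneg c), inv_mul_eq_div]
  rcases abs_choice c with h | h <;> rw [h]
  · exact Or.inl (div_self hc)
  · exact Or.inr (by rw [div_neg, div_self hc])

theorem exists_det_ne_zero_of_mul_self_eq_zero (hN : N * N = 0) (hN0 : N ≠ 0) :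
    ∃ v : Fin 2 → ℝ, (Matrix.of ![v, Matrix.vecMul v N]).det ≠ 0 := by
  by_contra! h
  have h01 : N 0 1 = 0 := by simpa [Matrix.det_fin_two] using h (Pi.single 0 1)
  have h10 : N 1 0 = 0 := by simpa [Matrix.det_fin_two] using h (Pi.single 1 1)
  have h00 : N 0 0 * N 0 0 = 0 := by
    simpa [Matrix.mul_apply, Fin.sum_univ_two, h01] using congrFun₂ hN 0 0
  have h11 : N 1 1 * N 1 1 = 0 := by
    simpa [Matrix.mul_apply, Fin.sum_univ_two, h10] using congrFun₂ hN 1 1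
  refine hN0 (Matrix.ext fun i j => ?_)
  fin_cases i <;> fin_cases j <;> simp_all

theorem exists_mul_eq_mul_of_mul_self_eq_zero (hN : N * N = 0) (hN0 : N ≠ 0) :
    ∃ P : Matrix (Fin 2) (Fin 2) ℝ, (P.det = 1 ∨ P.det = -1) ∧ P * N = !![0, 1; 0, 0] * P := by
  obtain ⟨v, hv⟩ := exists_det_ne_zero_of_mul_self_eq_zero hN hN0
  obtain ⟨r, hr⟩ := exists_mul_self_mul_eq_one_or_neg_one hv
  refine ⟨r • Matrix.of ![v, Matrix.vecMul v N], ?_, ?_⟩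
  · rwa [Matrix.det_smul, Fintype.card_fin, sq]
  · have hvN : Matrix.vecMul (Matrix.vecMul v N) N = 0 := by
      rw [Matrix.vecMul_vecMul, hN, Matrix.vecMul_zero]
    rw [Matrix.smul_mul, Matrix.mul_smul]
    congr 1
    ext i j
    fin_cases i
    · simp [Matrix.mul_apply, Matrix.vecMul, dotProduct]
    · simpa [Matrix.mul_apply, Matrix.vecMul, dotProduct] using congrFun hvN j

theorem IsNondiagDouble.mul_self_eq_zero {μ : ℝ} (h : IsNondiagDouble (Matrix.toLin' M) μ) :
    (M - Matrix.scalar _ μ) * (M - Matrix.scalar _ μ) = 0 := by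
  have hM := M.aeval_self_charpoly
  rw [← Matrix.charpoly_toLin', h.1] at hM
  rwa [map_pow, map_sub, Polynomial.aeval_X, Polynomial.aeval_C, sq] at hM

theorem IsNondiagDouble.ne_scalar {μ : ℝ} (h : IsNondiagDouble (Matrix.toLin' M) μ) :
    M ≠ Matrix.scalar _ μ := by
  rintro rfl
  refine h.2 ⟨Pi.basisFun ℝ (Fin 2), fun i => ⟨μ, ?_⟩⟩
  ext j
  simp [Matrix.mulVec_diagonal]

theorem IsNondiagDouble.exists_mul_eq_mul (h : IsNondiagDouble (Matrix.toLin' M) (-1)) :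
    ∃ P : Matrix (Fin 2) (Fin 2) ℝ, (P.det = 1 ∨ P.det = -1) ∧ P * M = -!![1, 1; 0, 1] * P := by
  have hsq := h.mul_self_eq_zero
  have hne := h.ne_scalar
  rw [map_neg, map_one] at hsq hne
  obtain ⟨P, hP, hPM⟩ := exists_mul_eq_mul_of_mul_self_eq_zero (N := -(M - -1))
    (by rw [neg_mul_neg, hsq]) (neg_ne_zero.mpr (sub_ne_zero.mpr hne))
  refine ⟨P, hP, ?_⟩
  have hunip : (!![1, 1; 0, 1] : Matrix (Fin 2) (Fin 2) ℝ) = 1 + !![0, 1; 0, 0] := by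
    simp [Matrix.one_fin_two]
  rw [hunip, neg_mul, add_mul, ← hPM, one_mul, mul_neg, mul_sub, mul_neg, mul_one]
  abel

theorem exists_eq_unipotent_or_eq_neg_of_commute (hM : Commute M !![1, 1; 0, 1])
    (hdet : M.det = 1 ∨ M.det = -1) : ∃ b, M = !![1, b; 0, 1] ∨ M = -!![1, b; 0, 1] := by
  have h00 := congrFun₂ hM.eq 0 0
  have h01 := congrFun₂ hM.eq 0 1
  simp only [Matrix.mul_apply, Fin.sum_univ_two] at h00 h01
  have h10 : M 1 0 = 0 := by simpa using h00
  have h11 : M 1 1 = M 0 0 := by simpa [add_comm (M 0 0)] using h01.symm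
  rw [Matrix.det_fin_two, h10, h11, mul_zero, sub_zero] at hdet
  have hdiag : M 0 0 = 1 ∨ M 0 0 = -1 := by
    refine mul_self_eq_one_iff.mp (hdet.resolve_right fun h => ?_)
    linarith [mul_self_nonneg (M 0 0)]
  rcases hdiag with h | h
  · exact ⟨M 0 1, Or.inl (by ext i j; fin_cases i <;> fin_cases j <;> simp [h, h10, h11])⟩
  · exact ⟨-M 0 1, Or.inr (by ext i j; fin_cases i <;> fin_cases j <;> simp [h, h10, h11])⟩

end LinearPart

section FormalNormalForm

variable {F G H T φ ψ φ' ψ' : FormalMap} {A B : Series →ₐ[ℝ] Series} {u v : ℕ → ℕ → ℝ}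

theorem IsCanonicalChange.symm (h : IsCanonicalChange φ ψ) : IsCanonicalChange ψ φ where
  fixes := h.fixes_inv
  area := by
    have hmul := jacobianDet_comp (G := φ) h.fixes_inv
    rw [h.right_inv, show jacobianDet idMap = 1 by simp [jacobianDet, idMap]] at hmul
    rcases h.area with h2 | h2
    · exact Or.inl (by simpa [h2] using hmul.symm)
    · exact Or.inr (by simpa [h2, neg_eq_iff_eq_neg] using hmul.symm)
  fixes_inv := h.fixes
  left_inv := h.right_inv
  right_inv := h.left_inv

theorem IsCanonicalChange.inv_comp_cancel (h : IsCanonicalChange φ ψ) (hG : FixesOrigin G) :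
    AreaPreservingNF.comp ψ (AreaPreservingNF.comp φ G) = G := by
  rw [← comp_assoc h.fixes hG, h.left_inv, idMap_comp hG]

theorem IsCanonicalChange.comp_inv_cancel (h : IsCanonicalChange φ ψ) (G : FormalMap) :
    AreaPreservingNF.comp (AreaPreservingNF.comp G φ) ψ = G := by
  rw [comp_assoc h.fixes h.fixes_inv, h.right_inv, comp_idMap]

theorem IsCanonicalChange.comp (h : IsCanonicalChange φ ψ) (h' : IsCanonicalChange φ' ψ') :
    IsCanonicalChange (comp φ φ') (comp ψ' ψ) where
  fixes := fixesOrigin_comp h.fixes h'.fixes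
  area := h.area.comp h'.area h'.fixes
  fixes_inv := fixesOrigin_comp h'.fixes_inv h.fixes_inv
  left_inv := by
    rw [comp_assoc h.fixes_inv (fixesOrigin_comp h.fixes h'.fixes), h.inv_comp_cancel h'.fixes,
      h'.left_inv]
  right_inv := by
    rw [comp_assoc h'.fixes (fixesOrigin_comp h'.fixes_inv h.fixes_inv),
      h'.symm.inv_comp_cancel h.fixes_inv, h.right_inv]

theorem HasNormalForm.conj (h : HasNormalForm T u) (hφ : IsCanonicalChange φ ψ) :
    HasNormalForm (comp ψ (comp T φ)) u := by
  obtain ⟨φ', ψ', h', rfl⟩ := h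
  refine ⟨comp φ' φ, comp ψ ψ', h'.comp hφ, ?_⟩
  have hN := fixesOrigin_neg_timeOne u
  rw [comp_assoc (fixesOrigin_comp hN h'.fixes) hφ.fixes, comp_assoc h'.fixes hφ.fixes,
    comp_assoc h'.fixes_inv (fixesOrigin_comp hN (fixesOrigin_comp h'.fixes hφ.fixes))]

theorem toMap_pull (hG : FixesOrigin G) : toMap (pull G hG) = G := by
  funext i
  fin_cases i <;> simp [toMap]

theorem comp_toMap (hB : ∀ i, constantCoeff (B (X i)) = 0) (hε : B (X 2) = X 2)
    (A : Series →ₐ[ℝ] Series) : comp (toMap A) (toMap B) = toMap (B.comp A) := by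
  rw [comp_eq_pull (fixesOrigin_toMap hB), pull_toMap hε]
  funext i
  fin_cases i <;> rfl

theorem IsNearIdentity.exists_inverse (hA : IsNearIdentity A) :
    ∃ A', A.comp A' = AlgHom.id ℝ Series ∧ IsCanonicalChange (toMap A) (toMap A') := by
  let e : Series ≃ₐ[ℝ] Series := AlgEquiv.ofBijective A hA.bijective
  let A' : Series →ₐ[ℝ] Series := e.symm
  have hAA' : A.comp A' = AlgHom.id ℝ Series := AlgHom.ext e.apply_symm_apply
  have hA'A : A'.comp A = AlgHom.id ℝ Series := AlgHom.ext e.symm_apply_apply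
  have hA'X : ∀ i, constantCoeff (A' (X i)) = 0 := fun i => by
    rw [← constantCoeff_algHom hA.constantCoeff_X (A' (X i)), ← AlgHom.comp_apply, hAA',
      AlgHom.id_apply, MvPowerSeries.constantCoeff_X]
  have hA'ε : A' (X 2) = X 2 := by
    have := DFunLike.congr_fun hA'A (X 2)
    rwa [AlgHom.comp_apply, hA.eps] at this
  refine ⟨A', hAA', fixesOrigin_toMap hA.constantCoeff_X, Or.inl ?_, fixesOrigin_toMap hA'X, ?_, ?_⟩
  · rw [jacobianDet_eq_lieDeriv]
    change lieDeriv (A (X 1)) (A (X 0)) = 1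
    rw [hA.poisson]
    simp
  · rw [comp_toMap hA.constantCoeff_X hA.eps, hAA']
    rfl
  · rw [comp_toMap hA'X hA'ε, hA'A]
    rfl

theorem hasNormalForm_of_comp_eq (hT : FixesOrigin T) (hA : IsNearIdentity A)
    (h : (pull T hT).comp A = A.comp (normalHom u)) : HasNormalForm T u := by
  obtain ⟨A', hAA', hφ⟩ := hA.exists_inverse
  refine ⟨toMap A, toMap A', hφ, ?_⟩
  have hX : ∀ i, constantCoeff (((pull T hT).comp A) (X i)) = 0 := fun i => by
    rw [AlgHom.comp_apply, constantCoeff_algHom (constantCoeff_pull_X hT), hA.constantCoeff_X]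
  have hε : ((pull T hT).comp A) (X 2) = X 2 := by
    rw [AlgHom.comp_apply, hA.eps, pull_X_two]
  rw [← toMap_normalHom, comp_toMap hA.constantCoeff_X hA.eps, ← h, comp_toMap hX hε,
    AlgHom.comp_assoc, hAA', AlgHom.comp_id, toMap_pull]

theorem exists_hasNormalForm_of_jacMatrix (hT : FixesOrigin T) (harea : IsAreaPreserving T)
    (hJ : jacMatrix T = -!![1, 1; 0, 1]) : ∃ u, HasNormalForm T u := by
  have hJ' : jacMatrix (-T) = !![1, 1; 0, 1] := by rw [jacMatrix_neg, hJ, neg_neg]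
  have h01 : constantCoeff (dy ((-T) 0)) = 1 := congrFun₂ hJ' 0 1
  rw [← coeff_zero_eq_constantCoeff_apply, coeff_dy] at h01
  obtain ⟨A, u, hA, hrel⟩ := exists_conjugacy (isNearIdentity_pull hT.neg harea.neg hJ')
    (by simpa using h01)
  refine ⟨u, hasNormalForm_of_comp_eq hT hA (AlgHom.ext fun f => ?_)⟩
  have h := LinearMap.congr_fun hrel (refl f)
  rw [pull_neg hT, conj_eq_mul] at h
  simpa [normalHom, normalExp] using h

theorem exists_hasNormalForm (hF : IsAreaPreserving F) (hF0 : FixesOrigin F)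
    (hlin : IsNondiagDouble (linearPart F) (-1)) : ∃ u, HasNormalForm F u := by
  rw [linearPart_eq_toLin'] at hlin
  obtain ⟨P, hP, hPM⟩ := hlin.exists_mul_eq_mul
  have hφ := isCanonicalChange_linMap hP
  have hFψ := fixesOrigin_comp hF0 hφ.fixes_inv
  have hJ : jacMatrix (comp (linMap P) (comp F (linMap P⁻¹))) = -!![1, 1; 0, 1] := by
    rw [jacMatrix_comp hFψ, jacMatrix_comp hφ.fixes_inv, jacMatrix_linMap, jacMatrix_linMap,
      ← mul_assoc, hPM, mul_assoc,
      Matrix.mul_nonsing_inv _ (by rcases hP with h | h <;> simp [h]), mul_one]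
  obtain ⟨u, hu⟩ := exists_hasNormalForm_of_jacMatrix (fixesOrigin_comp hφ.fixes hFψ)
    (hφ.area.comp (hF.comp hφ.symm.area hφ.fixes_inv) hFψ) hJ
  refine ⟨u, ?_⟩
  have hconj := hu.conj hφ
  rwa [comp_assoc hFψ hφ.fixes, hφ.inv_comp_cancel (fixesOrigin_comp hFψ hφ.fixes),
    hφ.symm.comp_inv_cancel] at hconj

theorem jacMatrix_neg_timeOne (hu : ∀ m, u 0 m = 0) :
    jacMatrix (-timeOne (normalHam u)) = -!![1, 1; 0, 1] := by
  have hexp := normalExp_sub_one_sub_lieOp_kinetic_mem_raising hu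
  have h0 : lieExp (normalHam u) (X 0) - X 0 - lieDeriv kinetic (X 0) ∈ 𝓕 4 :=
    hexp _ _ (X_mem_weightIdeal 0)
  have h1 : lieExp (normalHam u) (X 1) - X 1 - lieDeriv kinetic (X 1) ∈ 𝓕 5 :=
    hexp _ _ (X_mem_weightIdeal 1)
  rw [lieDeriv_X_zero, dy_kinetic, sub_sub] at h0
  rw [lieDeriv_X_one, dx_kinetic, neg_zero, sub_zero] at h1
  rw [jacMatrix_neg, jacMatrix_congr (H := linMap !![1, 1; 0, 1]), jacMatrix_linMap]
  intro i
  fin_cases i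
  · simpa [timeOne, linMap] using h0
  · simpa [timeOne, linMap] using fil_mono h1 (by omega)

theorem HasNormalForm.exists_comp_eq (h : HasNormalForm T u) (h' : HasNormalForm T v) :
    ∃ c, FixesOrigin c ∧ IsAreaPreserving c ∧
      comp (-timeOne (normalHam u)) c = comp c (-timeOne (normalHam v)) := by
  obtain ⟨φ₁, ψ₁, h₁, hT₁⟩ := h
  obtain ⟨φ₂, ψ₂, h₂, hT₂⟩ := h'
  have hNφ₁ := fixesOrigin_comp (fixesOrigin_neg_timeOne u) h₁.fixes
  have hNφ₂ := fixesOrigin_comp (fixesOrigin_neg_timeOne v) h₂.fixes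
  have hT : FixesOrigin T := hT₁ ▸ fixesOrigin_comp h₁.fixes_inv hNφ₁
  refine ⟨comp φ₁ ψ₂, fixesOrigin_comp h₁.fixes h₂.fixes_inv,
    h₁.area.comp h₂.symm.area h₂.fixes_inv, ?_⟩
  calc comp (-timeOne (normalHam u)) (comp φ₁ ψ₂)
      = comp (comp (-timeOne (normalHam u)) φ₁) ψ₂ := (comp_assoc h₁.fixes h₂.fixes_inv).symm
    _ = comp (comp φ₁ T) ψ₂ := by rw [hT₁, h₁.symm.inv_comp_cancel hNφ₁]
    _ = comp φ₁ (comp T ψ₂) := comp_assoc hT h₂.fixes_inv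
    _ = comp φ₁ (comp ψ₂ (-timeOne (normalHam v))) := by
      rw [hT₂, comp_assoc hNφ₂ h₂.fixes_inv, h₂.comp_inv_cancel]
    _ = comp (comp φ₁ ψ₂) (-timeOne (normalHam v)) :=
      (comp_assoc h₂.fixes_inv (fixesOrigin_neg_timeOne v)).symm

theorem normalHom_comp_refl (u : ℕ → ℕ → ℝ) :
    (normalHom u).comp refl = refl.comp (normalHom u) := by
  refine AlgHom.ext fun f => ?_
  have h := LinearMap.congr_fun (conj_normalExp u) f
  simp only [AlgHom.comp_apply, normalHom, refl_refl]
  exact h.symm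

theorem potential_eq_of_comp_eq (hu : ∀ m, u 0 m = 0) (hv : ∀ m, v 0 m = 0)
    (hA : IsNearIdentity A) (h : A.comp (normalHom u) = (normalHom v).comp A) :
    potential v = potential u := by
  refine IsNormalConjugacy.potential_eq hu hv ⟨hA, hA.sub_one_mem_raising, ?_⟩
  refine LinearMap.ext fun f => ?_
  have := DFunLike.congr_fun h (refl f)
  simpa [conj_eq_mul, normalHom, normalExp] using this

theorem exists_isNearIdentity_comp_eq (hu : ∀ m, u 0 m = 0) (hv : ∀ m, v 0 m = 0) {c : FormalMap}
    (hc : FixesOrigin c) (harea : IsAreaPreserving c)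
    (h : comp (-timeOne (normalHam u)) c = comp c (-timeOne (normalHam v))) :
    ∃ A, IsNearIdentity A ∧ A.comp (normalHom u) = (normalHom v).comp A := by
  have hNu := fixesOrigin_neg_timeOne u
  have hNv := fixesOrigin_neg_timeOne v
  have hpull : (pull c hc).comp (normalHom u) = (normalHom v).comp (pull c hc) := by
    rw [← pull_neg_timeOne u, ← pull_neg_timeOne v, ← pull_comp hNu hc (fixesOrigin_comp hNu hc),
      ← pull_comp hc hNv (fixesOrigin_comp hc hNv)]
    congr 1
  have hJ := congrArg jacMatrix h
  rw [jacMatrix_comp hc, jacMatrix_comp hNv, jacMatrix_neg_timeOne hu, jacMatrix_neg_timeOne hv,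
    neg_mul, mul_neg, neg_inj] at hJ
  obtain ⟨b, hb | hb⟩ := exists_eq_unipotent_or_eq_neg_of_commute hJ.symm harea.det_jacMatrix
  · exact ⟨_, isNearIdentity_pull hc harea hb, hpull⟩
  · have hb' : jacMatrix (-c) = !![1, b; 0, 1] := by rw [jacMatrix_neg, hb, neg_neg]
    refine ⟨_, isNearIdentity_pull hc.neg harea.neg hb', ?_⟩
    rw [pull_neg hc, AlgHom.comp_assoc, ← normalHom_comp_refl, ← AlgHom.comp_assoc, hpull,
      AlgHom.comp_assoc]

theorem HasNormalForm.zero_left (h : HasNormalForm T u) :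
    HasNormalForm T fun k m => if k = 0 then 0 else u k m := by
  obtain ⟨φ, ψ, h1, h2⟩ := h
  refine ⟨φ, ψ, h1, ?_⟩
  rw [h2, timeOne_normalHam_congr fun k m hk => (if_neg hk).symm]

theorem HasNormalForm.coeff_eq (h : HasNormalForm T u) (h' : HasNormalForm T v) {k m : ℕ}
    (hk : 1 ≤ k) (hkm : 2 ≤ k + 2 * m) : u k m = v k m := by
  obtain ⟨c, hc, harea, hcomm⟩ := h.zero_left.exists_comp_eq h'.zero_left
  obtain ⟨A, hA, hrel⟩ := exists_isNearIdentity_comp_eq (by simp) (by simp) hc harea hcomm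
  have hpot := congrArg (coeff (Finsupp.single 0 (2 * k) + Finsupp.single 2 m))
    (potential_eq_of_comp_eq (by simp) (by simp) hA hrel)
  rw [coeff_potential_of_le _ hkm, coeff_potential_of_le _ hkm, if_neg (by omega),
    if_neg (by omega)] at hpot
  exact hpot.symm

end FormalNormalForm

/-! ### Taylor series of smooth families -/

section TaylorSeries

open Filter Topology

variable {f g : ℝ × (Fin 2 → ℝ) → ℝ} {p : ℝ × (Fin 2 → ℝ)}

theorem mem_fil_succ_of_pderiv {h : Series} {N : ℕ} (h0 : constantCoeff h = 0)
    (hd : ∀ j, pderiv ℝ j h ∈ 𝓕 N) : h ∈ 𝓕 (N + 1) := by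
  rw [mem_fil]
  intro n hn
  rcases eq_or_ne n 0 with rfl | hn0
  · exact h0
  · obtain ⟨j, hj⟩ := Finsupp.ne_iff.mp hn0
    refine coeff_eq_zero_of_pderiv_mem_weightIdeal (hd j) hj ?_
    have := varWeight_pos j
    rw [weight_varWeight]
    omega

theorem partialDeriv_congr (h : f =ᶠ[𝓝 p] g) (j : Fin 3) :
    partialDeriv j f =ᶠ[𝓝 p] partialDeriv j g := by
  filter_upwards [h.fderiv (𝕜 := ℝ)] with q hq
  rw [partialDeriv, partialDeriv, hq]

theorem iterate_partialDeriv_congr (h : f =ᶠ[𝓝 p] g) (j : Fin 3) (k : ℕ) :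
    (partialDeriv j)^[k] f =ᶠ[𝓝 p] (partialDeriv j)^[k] g := by
  induction k generalizing f g with
  | zero => exact h
  | succ _ ih => exact ih (partialDeriv_congr h j)

theorem contDiffAt_partialDeriv (hf : ContDiffAt ℝ ∞ f p) (j : Fin 3) :
    ContDiffAt ℝ ∞ (partialDeriv j f) p :=
  (hf.fderiv_right (by simp)).clm_apply contDiffAt_const

theorem contDiffAt_iterate_partialDeriv (hf : ContDiffAt ℝ ∞ f p) (j : Fin 3) (k : ℕ) :
    ContDiffAt ℝ ∞ ((partialDeriv j)^[k] f) p := by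
  induction k generalizing f with
  | zero => exact hf
  | succ _ ih => exact ih (contDiffAt_partialDeriv hf j)

theorem eventually_contDiffAt {E F : Type*} [NormedAddCommGroup E] [NormedSpace ℝ E]
    [NormedAddCommGroup F] [NormedSpace ℝ F] {f : E → F} {p : E} (hf : ContDiffAt ℝ ∞ f p)
    (n : ℕ) : ∀ᶠ q in 𝓝 p, ContDiffAt ℝ n f q :=
  (hf.of_le (by exact_mod_cast le_top)).eventually (by simp)

theorem eventually_differentiableAt {E F : Type*} [NormedAddCommGroup E] [NormedSpace ℝ E]
    [NormedAddCommGroup F] [NormedSpace ℝ F] {f : E → F} {p : E} (hf : ContDiffAt ℝ ∞ f p) :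
    ∀ᶠ q in 𝓝 p, DifferentiableAt ℝ f q :=
  (eventually_contDiffAt hf 1).mono fun _ h => h.differentiableAt (by simp)

theorem partialDeriv_comm (hf : ContDiffAt ℝ 2 f p) (i j : Fin 3) :
    partialDeriv i (partialDeriv j f) p = partialDeriv j (partialDeriv i f) p := by
  have hd : DifferentiableAt ℝ (fderiv ℝ f) p :=
    (hf.fderiv_right (m := 1) (by norm_num)).differentiableAt (by simp)
  have h : ∀ i j, partialDeriv i (partialDeriv j f) p =
      fderiv ℝ (fderiv ℝ f) p (unitVec i) (unitVec j) := fun i j => by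
    unfold partialDeriv
    rw [fderiv_clm_apply hd (differentiableAt_const _)]
    simp
  rw [h, h]
  exact (hf.isSymmSndFDerivAt (by simp)).eq _ _

theorem partialDeriv_iterate_comm (hf : ContDiffAt ℝ ∞ f p) (i j : Fin 3) (k : ℕ) :
    partialDeriv i ((partialDeriv j)^[k] f) =ᶠ[𝓝 p] (partialDeriv j)^[k] (partialDeriv i f) := by
  induction k generalizing f with
  | zero => rfl
  | succ k ih =>
    rw [Function.iterate_succ_apply, Function.iterate_succ_apply]
    exact (ih (contDiffAt_partialDeriv hf j)).trans (iterate_partialDeriv_congr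
      ((eventually_contDiffAt hf 2).mono fun _ h => partialDeriv_comm h i j) j k)

/-- The mixed partial derivative `∂ₓᵏ ∂ᵧˡ ∂_εᵐ f` for `n = (k, l, m)`. -/
def mixedDeriv (n : Fin 3 →₀ ℕ) (f : ℝ × (Fin 2 → ℝ) → ℝ) : ℝ × (Fin 2 → ℝ) → ℝ :=
  (partialDeriv 0)^[n 0] ((partialDeriv 1)^[n 1] ((partialDeriv 2)^[n 2] f))

theorem mixedDeriv_congr (h : f =ᶠ[𝓝 p] g) (n : Fin 3 →₀ ℕ) :
    mixedDeriv n f =ᶠ[𝓝 p] mixedDeriv n g :=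
  iterate_partialDeriv_congr (iterate_partialDeriv_congr (iterate_partialDeriv_congr h _ _) _ _) _ _

theorem mixedDeriv_add_single (hf : ContDiffAt ℝ ∞ f p) (n : Fin 3 →₀ ℕ) (j : Fin 3) :
    mixedDeriv (n + Finsupp.single j 1) f =ᶠ[𝓝 p] mixedDeriv n (partialDeriv j f) := by
  unfold mixedDeriv
  fin_cases j
  · simp only [Fin.zero_eta, Finsupp.add_apply, Finsupp.single_eq_same, ne_eq, Fin.reduceEq,
      not_false_eq_true, Finsupp.single_eq_of_ne, add_zero, Function.iterate_succ_apply]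
    refine iterate_partialDeriv_congr ?_ 0 _
    exact (partialDeriv_iterate_comm (contDiffAt_iterate_partialDeriv hf 2 _) 0 1 _).trans
      (iterate_partialDeriv_congr (partialDeriv_iterate_comm hf 0 2 _) 1 _)
  · simp only [Fin.mk_one, Finsupp.add_apply, Finsupp.single_eq_same, ne_eq, Fin.reduceEq,
      not_false_eq_true, Finsupp.single_eq_of_ne, add_zero, Function.iterate_succ_apply]
    exact iterate_partialDeriv_congr (iterate_partialDeriv_congr
      (partialDeriv_iterate_comm hf 1 2 _) 1 _) 0 _
  · simp only [Fin.reduceFinMk, Finsupp.add_apply, Finsupp.single_eq_same, ne_eq, Fin.reduceEq,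
      not_false_eq_true, Finsupp.single_eq_of_ne, add_zero, Function.iterate_succ_apply]
    rfl

/-- The Taylor series at the origin of a function of `(ε, (x, y))`, so that `taylor F i` is the
Taylor series of the component `i` of `F`. -/
def taylorSeries (f : ℝ × (Fin 2 → ℝ) → ℝ) : Series := fun n =>
  mixedDeriv n f (0, 0) / ((n 0).factorial * (n 1).factorial * (n 2).factorial : ℝ)

theorem taylor_apply (F : ℝ → (Fin 2 → ℝ) → (Fin 2 → ℝ)) (i : Fin 2) :
    taylor F i = taylorSeries fun q => F q.1 q.2 i := rfl

theorem coeff_taylorSeries (f : ℝ × (Fin 2 → ℝ) → ℝ) (n : Fin 3 →₀ ℕ) :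
    coeff n (taylorSeries f) =
      mixedDeriv n f (0, 0) / ((n 0).factorial * (n 1).factorial * (n 2).factorial : ℝ) := rfl

theorem taylorSeries_congr (h : f =ᶠ[𝓝 (0, 0)] g) : taylorSeries f = taylorSeries g := by
  ext n
  rw [coeff_taylorSeries, coeff_taylorSeries, (mixedDeriv_congr h n).eq_of_nhds]

theorem constantCoeff_taylorSeries (f : ℝ × (Fin 2 → ℝ) → ℝ) :
    constantCoeff (taylorSeries f) = f (0, 0) := by
  rw [← coeff_zero_eq_constantCoeff_apply, coeff_taylorSeries]
  simp [mixedDeriv]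

theorem pderiv_taylorSeries (hf : ContDiffAt ℝ ∞ f (0, 0)) (j : Fin 3) :
    pderiv ℝ j (taylorSeries f) = taylorSeries (partialDeriv j f) := by
  ext n
  have hfactorial : (((n + Finsupp.single j 1 : Fin 3 →₀ ℕ) 0).factorial *
      ((n + Finsupp.single j 1 : Fin 3 →₀ ℕ) 1).factorial *
      ((n + Finsupp.single j 1 : Fin 3 →₀ ℕ) 2).factorial : ℝ) =
      (n 0).factorial * (n 1).factorial * (n 2).factorial * (n j + 1) := by
    fin_cases j <;> simp [Nat.factorial_succ] <;> ring
  have hj : (n j : ℝ) + 1 ≠ 0 := by positivity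
  rw [coeff_pderiv, coeff_taylorSeries, coeff_taylorSeries,
    (mixedDeriv_add_single hf n j).eq_of_nhds, hfactorial, div_mul_eq_div_div, div_mul_cancel₀ _ hj]

theorem partialDeriv_add (hf : ContDiffAt ℝ ∞ f p) (hg : ContDiffAt ℝ ∞ g p) (j : Fin 3) :
    partialDeriv j (f + g) =ᶠ[𝓝 p] partialDeriv j f + partialDeriv j g := by
  filter_upwards [eventually_differentiableAt hf, eventually_differentiableAt hg] with q hf hg
  rw [partialDeriv, fderiv_add hf hg]
  rfl

theorem partialDeriv_mul (hf : ContDiffAt ℝ ∞ f p) (hg : ContDiffAt ℝ ∞ g p) (j : Fin 3) :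
    partialDeriv j (f * g) =ᶠ[𝓝 p] f * partialDeriv j g + g * partialDeriv j f := by
  filter_upwards [eventually_differentiableAt hf, eventually_differentiableAt hg] with q hf hg
  rw [partialDeriv, fderiv_mul hf hg]
  rfl

theorem taylorSeries_add (hf : ContDiffAt ℝ ∞ f (0, 0)) (hg : ContDiffAt ℝ ∞ g (0, 0)) :
    taylorSeries (f + g) = taylorSeries f + taylorSeries g := by
  refine eq_of_forall_sub_mem_fil fun N => ?_
  induction N generalizing f g with
  | zero => simp
  | succ N ih =>
    refine mem_fil_succ_of_pderiv ?_ fun j => ?_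
    · simp [constantCoeff_taylorSeries]
    · rw [map_sub, map_add, pderiv_taylorSeries (f := f + g) (hf.add hg), pderiv_taylorSeries hf,
        pderiv_taylorSeries hg, taylorSeries_congr (partialDeriv_add hf hg j)]
      exact ih (contDiffAt_partialDeriv hf j) (contDiffAt_partialDeriv hg j)

theorem taylorSeries_sub (hf : ContDiffAt ℝ ∞ f (0, 0)) (hg : ContDiffAt ℝ ∞ g (0, 0)) :
    taylorSeries (f - g) = taylorSeries f - taylorSeries g := by
  rw [eq_sub_iff_add_eq, ← taylorSeries_add (f := f - g) (hf.sub hg) hg, sub_add_cancel]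

theorem taylorSeries_mul (hf : ContDiffAt ℝ ∞ f (0, 0)) (hg : ContDiffAt ℝ ∞ g (0, 0)) :
    taylorSeries (f * g) = taylorSeries f * taylorSeries g := by
  refine eq_of_forall_sub_mem_fil fun N => ?_
  induction N generalizing f g with
  | zero => simp
  | succ N ih =>
    refine mem_fil_succ_of_pderiv ?_ fun j => ?_
    · simp [constantCoeff_taylorSeries]
    · have hf' := contDiffAt_partialDeriv hf j
      have hg' := contDiffAt_partialDeriv hg j
      rw [map_sub, Derivation.leibniz, pderiv_taylorSeries (f := f * g) (hf.mul hg),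
        pderiv_taylorSeries hf, pderiv_taylorSeries hg,
        taylorSeries_congr (partialDeriv_mul hf hg j),
        taylorSeries_add (f := f * _) (g := g * _) (hf.mul hg') (hg.mul hf'), add_sub_add_comm]
      exact add_mem (ih hf hg') (ih hg hf')

theorem taylorSeries_const (c : ℝ) : taylorSeries (fun _ => c) = C c := by
  refine eq_of_forall_sub_mem_fil fun N => ?_
  induction N generalizing c with
  | zero => simp
  | succ N ih =>
    refine mem_fil_succ_of_pderiv ?_ fun j => ?_
    · simp [constantCoeff_taylorSeries]
    · have h : partialDeriv j (fun _ => c) = fun _ => 0 := by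
        funext q
        simp [partialDeriv]
      rw [map_sub, pderiv_taylorSeries contDiffAt_const, h, pderiv_C, ← map_zero C]
      exact ih 0

end TaylorSeries

section SmoothFamily

open Filter Topology

variable {F : ℝ → (Fin 2 → ℝ) → (Fin 2 → ℝ)} {q : ℝ × (Fin 2 → ℝ)}

/-- The Jacobian matrix with respect to `(x, y)` of the family `F`, as a function of
`(ε, (x, y))`. -/
def familyJacobian (F : ℝ → (Fin 2 → ℝ) → (Fin 2 → ℝ)) (q : ℝ × (Fin 2 → ℝ)) :
    Matrix (Fin 2) (Fin 2) ℝ :=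
  !![partialDeriv 0 (fun q => F q.1 q.2 0) q, partialDeriv 1 (fun q => F q.1 q.2 0) q;
     partialDeriv 0 (fun q => F q.1 q.2 1) q, partialDeriv 1 (fun q => F q.1 q.2 1) q]

theorem fderiv_family_apply
    (h : DifferentiableAt ℝ (fun q : ℝ × (Fin 2 → ℝ) => F q.1 q.2) q) (v : Fin 2 → ℝ) (i : Fin 2) :
    fderiv ℝ (F q.1) q.2 v i = fderiv ℝ (fun q => F q.1 q.2 i) q (0, v) := by
  have hslice : HasFDerivAt (F q.1) ((fderiv ℝ (fun q : ℝ × (Fin 2 → ℝ) => F q.1 q.2) q).comp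
      (ContinuousLinearMap.inr ℝ ℝ (Fin 2 → ℝ))) q.2 :=
    HasFDerivAt.comp q.2 (f := fun z => (q.1, z))
      (g := fun q : ℝ × (Fin 2 → ℝ) => F q.1 q.2) h.hasFDerivAt (hasFDerivAt_prodMk_right q.1 q.2)
  rw [hslice.fderiv, (hasFDerivAt_pi'.mp h.hasFDerivAt i).fderiv]
  rfl

theorem toMatrix'_fderiv_family
    (h : DifferentiableAt ℝ (fun q : ℝ × (Fin 2 → ℝ) => F q.1 q.2) q) :
    LinearMap.toMatrix' (fderiv ℝ (F q.1) q.2 : (Fin 2 → ℝ) →ₗ[ℝ] (Fin 2 → ℝ)) =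
      familyJacobian F q := by
  have he₀ : (Pi.single 0 1 : Fin 2 → ℝ) = ![1, 0] := by
    ext i; fin_cases i <;> simp
  have he₁ : (Pi.single 1 1 : Fin 2 → ℝ) = ![0, 1] := by
    ext i; fin_cases i <;> simp
  ext i j
  fin_cases i <;> fin_cases j <;>
    simp [LinearMap.toMatrix'_apply, familyJacobian, partialDeriv, unitVec, he₀, he₁,
      fderiv_family_apply h]

theorem linearPart_taylor (hF : ContDiffAt ℝ ∞ (fun q : ℝ × (Fin 2 → ℝ) => F q.1 q.2) (0, 0)) :
    linearPart (taylor F) = (fderiv ℝ (F 0) 0 : (Fin 2 → ℝ) →ₗ[ℝ] (Fin 2 → ℝ)) := by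
  have hjac : jacMatrix (taylor F) = familyJacobian F (0, 0) := by
    simp only [jacMatrix, dx, dy, taylor_apply, pderiv_taylorSeries (contDiffAt_pi.mp hF _),
      constantCoeff_taylorSeries, familyJacobian]
  rw [linearPart_eq_toLin', hjac,
    ← toMatrix'_fderiv_family (eventually_differentiableAt hF).self_of_nhds,
    Matrix.toLin'_toMatrix']

theorem jacobianDet_taylor
    (hF : ContDiffAt ℝ ∞ (fun q : ℝ × (Fin 2 → ℝ) => F q.1 q.2) (0, 0)) :
    jacobianDet (taylor F) = taylorSeries fun q => (familyJacobian F q).det := by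
  have hs : ∀ i j, ContDiffAt ℝ ∞ (partialDeriv j fun q => F q.1 q.2 i) (0, 0) :=
    fun i => contDiffAt_partialDeriv (contDiffAt_pi.mp hF i)
  have hdet : (fun q => (familyJacobian F q).det) =
      partialDeriv 0 (fun q => F q.1 q.2 0) * partialDeriv 1 (fun q => F q.1 q.2 1) -
        partialDeriv 1 (fun q => F q.1 q.2 0) * partialDeriv 0 (fun q => F q.1 q.2 1) :=
    funext fun q => Matrix.det_fin_two_of _ _ _ _
  rw [hdet, taylorSeries_sub (f := _ * _) (g := _ * _) ((hs 0 0).mul (hs 1 1))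
      ((hs 0 1).mul (hs 1 0)),
    taylorSeries_mul (hs 0 0) (hs 1 1), taylorSeries_mul (hs 0 1) (hs 1 0)]
  simp only [jacobianDet, dx, dy, taylor_apply, pderiv_taylorSeries (contDiffAt_pi.mp hF _)]

theorem eventually_eq_of_abs_eq_one {X : Type*} [TopologicalSpace X] {J : X → ℝ} {p : X}
    (hJ : ContinuousAt J p) (h : ∀ᶠ q in 𝓝 p, |J q| = 1) : ∀ᶠ q in 𝓝 p, J q = J p := by
  filter_upwards [h, hJ.eventually (Metric.ball_mem_nhds _ one_pos)] with q hq hdist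
  rw [Real.dist_eq] at hdist
  rcases eq_or_eq_neg_of_abs_eq hq with h₁ | h₁ <;>
    rcases eq_or_eq_neg_of_abs_eq h.self_of_nhds with h₂ | h₂ <;>
    rw [h₁, h₂] at hdist ⊢ <;> norm_num at hdist

theorem isAreaPreserving_taylor
    (hF : ContDiffAt ℝ ∞ (fun q : ℝ × (Fin 2 → ℝ) => F q.1 q.2) (0, 0))
    (hdet : ∀ᶠ q : ℝ × (Fin 2 → ℝ) in 𝓝 (0, 0), |(fderiv ℝ (F q.1) q.2).det| = 1) :
    IsAreaPreserving (taylor F) := by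
  have hs : ∀ i j, ContDiffAt ℝ ∞ (partialDeriv j fun q => F q.1 q.2 i) (0, 0) :=
    fun i => contDiffAt_partialDeriv (contDiffAt_pi.mp hF i)
  have hcont : ContinuousAt (fun q => (familyJacobian F q).det) (0, 0) := by
    simp only [familyJacobian, Matrix.det_fin_two_of]
    exact (((hs 0 0).mul (hs 1 1)).sub ((hs 0 1).mul (hs 1 0))).continuousAt
  have habs : ∀ᶠ q in 𝓝 (0, 0), |(familyJacobian F q).det| = 1 := by
    filter_upwards [hdet, eventually_differentiableAt hF] with q hq hdiff
    rw [← hq, ContinuousLinearMap.det, ← LinearMap.det_toMatrix', toMatrix'_fderiv_family hdiff]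
  rw [IsAreaPreserving, jacobianDet_taylor hF,
    taylorSeries_congr (eventually_eq_of_abs_eq_one hcont habs), taylorSeries_const]
  rcases eq_or_eq_neg_of_abs_eq habs.self_of_nhds with h | h <;> simp [h]

theorem fixesOrigin_taylor (hF : F 0 0 = 0) : FixesOrigin (taylor F) := fun i => by
  rw [taylor_apply, constantCoeff_taylorSeries, hF, Pi.zero_apply]

end SmoothFamily

end AreaPreservingNF

end

/-- The first part concerns formal families, the second one families of class `C^∞` or analytic,
for which the normal form is that of the Taylor series. -/
theorem theorem3 :
    (∀ F : AreaPreservingNF.FormalMap,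
      AreaPreservingNF.IsAreaPreserving F →
      AreaPreservingNF.FixesOrigin F →
      AreaPreservingNF.IsNondiagDouble (AreaPreservingNF.linearPart F) (-1) →
        (∃ u : ℕ → ℕ → ℝ, AreaPreservingNF.HasNormalForm F u) ∧
        ∀ u v : ℕ → ℕ → ℝ,
          AreaPreservingNF.HasNormalForm F u → AreaPreservingNF.HasNormalForm F v →
            ∀ k m : ℕ, 1 ≤ k → 2 ≤ k + 2 * m → u k m = v k m) ∧
    (∀ (r : WithTop ℕ∞) (F : ℝ → (Fin 2 → ℝ) → (Fin 2 → ℝ)) (U : Set (ℝ × (Fin 2 → ℝ))),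
      (r = ∞ ∨ r = ω) →
      IsOpen U → (0, 0) ∈ U →
      ContDiffOn ℝ r (fun q : ℝ × (Fin 2 → ℝ) => F q.1 q.2) U →
      (∀ q ∈ U, |(fderiv ℝ (F q.1) q.2).det| = 1) →
      F 0 0 = 0 →
      AreaPreservingNF.IsNondiagDouble (fderiv ℝ (F 0) 0 : (Fin 2 → ℝ) →ₗ[ℝ] (Fin 2 → ℝ)) (-1) →
        (∃ u : ℕ → ℕ → ℝ, AreaPreservingNF.HasNormalForm (AreaPreservingNF.taylor F) u) ∧
        ∀ u v : ℕ → ℕ → ℝ,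
          AreaPreservingNF.HasNormalForm (AreaPreservingNF.taylor F) u →
          AreaPreservingNF.HasNormalForm (AreaPreservingNF.taylor F) v →
            ∀ k m : ℕ, 1 ≤ k → 2 ≤ k + 2 * m → u k m = v k m) := by
  refine ⟨fun F hF hF0 hlin => ⟨AreaPreservingNF.exists_hasNormalForm hF hF0 hlin,
    fun u v hu hv k m => hu.coeff_eq hv⟩, ?_⟩
  intro r F U hr hU h0 hF hdet hF0 hlin
  have hU0 : U ∈ nhds (0, 0) := hU.mem_nhds h0
  have hsmooth : ContDiffAt ℝ ∞ (fun q : ℝ × (Fin 2 → ℝ) => F q.1 q.2) (0, 0) := by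
    refine (hF.contDiffAt hU0).of_le ?_
    rcases hr with rfl | rfl
    · exact le_rfl
    · exact le_top
  rw [← AreaPreservingNF.linearPart_taylor hsmooth] at hlin
  have harea : AreaPreservingNF.IsAreaPreserving (AreaPreservingNF.taylor F) :=
    AreaPreservingNF.isAreaPreserving_taylor hsmooth (Filter.eventually_of_mem hU0 hdet)
  exact ⟨AreaPreservingNF.exists_hasNormalForm harea (AreaPreservingNF.fixesOrigin_taylor hF0) hlin,
    fun u v hu hv k m => hu.coeff_eq hv⟩
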